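/- **Setting.** Let $\rho$ be a measure on $\mathbb R$ and, for $\theta$ in the interior $\Theta$ of $\{\theta:\int e^{x\theta}d\rho(x)<\infty\}$, let $\frac{d\nu_\theta}{d\rho}(x)=e^{x\theta-b(\theta)}$ with $b(\theta)=\log\int e^{x\theta}d\rho(x)$. Let $I$ be the set of the means of the $\nu_\theta$, $\theta\in\Theta$, and assume that $\rho$-almost every $x$ lies in the closure of $I$ (so that empirical means are mean values or limits of mean values). For $x,y\in I$ let $d(x,y)$ be the Kullback–Leibler divergence between the members of the family with means $x$ and $y$; for other real $x,y$ let $d(x,y)=\liminf_{(z,w)\to(x,y),\,z,w\in I}d(z,w)$, which is $+\infty$ if $(x,y)\notin\overline I\times\overline I$. A bandit instance is $\mu=(\mu_1,\dots,\mu_n)\in I^n$ with $\mu_1>\mu_i$ for all $i\ne1$; all rewards are independent, and those of arm $i$ follow the member of the family with mean $\mu_i$. The empirical mean of arm $i$ after a total of $t$ pulls is $\hat\mu_i(t)$, its number of pulls is $N_i(t)$, and $i^*(t)\in\arg\max_i\hat\mu_i(t)$, with any rule for breaking ties. For $b\in\mathbb R^n$ with designated best arm $k$, let $\mathrm{Alt}_k$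 be the set of $\lambda\in I^n$ that have a unique largest entry, at an index other than $k$; put $T^*(b)^{-1}=\sup_{w}\inf_{\lambda\in\mathrm{Alt}_k}\sum_iw_id(b_i,\lambda_i)$, the supremum being over the probability simplex, and let $w^*(b)$ be a point of the simplex that attains this supremum (any point of the simplex if it is not attained). (Conventions: $1/0=\infty$, $1/\infty=0$, $0\cdot\infty=0$.) **Algorithm Tri-BBAI** with parameters $\epsilon,\delta,L_1,L_2,L_3,\alpha$ and $\beta(t,\delta)$ (numbers of pulls are rounded up to integers, the number of batches is rounded down). - *Stage I.* Pull each arm $L_1$ times. Put $T^0_i=L_1$ and $w^*(b^0)=(1/n,\dots,1/n)$. - *Stage II.* For $q=1,2,\dots,\log(1/\delta)$: let $t$ be the current number of pulls, $k=i^*(t)$, $b^q_k=\hat\mu_k(t)-\epsilon$, and $b^q_i=\hat\mu_i(t)+\epsilon$ for $i\neq k$; compute $w^*(b^q)$ and $T^*(b^q)$ with designated best arm $k$; put $T^q_i=\min\{\alpha w^*_i(b^q)T^*(b^q)\log\delta^{-1},L_2\}$ and pull each arm $i$ until it has been pulled $\max_{0\le p\le q}T^p_i$ times in total; leave the loop if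 $|w^*_i(b^q)-w^*_i(b^{q-1})|\le1/\sqrt n$ for all $i$. Let $\tau$ be the number of pulls made so far. - *Stage III.* With $\hat\mu_{ij}=\frac{N_i\hat\mu_i+N_j\hat\mu_j}{N_i+N_j}$ and $Z_j=N_{i^*}d(\hat\mu_{i^*},\hat\mu_{i^*j})+N_jd(\hat\mu_j,\hat\mu_{i^*j})$, all taken at time $\tau$ with $i^*=i^*(\tau)$: if $\min_{j\ne i^*(\tau)}Z_j\ge\beta(\tau,\delta/2)$, return $i^*(\tau)$. - *Stage IV.* Otherwise pull each arm until it has been pulled $L_3$ times in total, and return the arm with the largest empirical mean. **Theorem (Correctness).** Let $\alpha\in(1,e/2]$, and let $\epsilon=\frac1{\log\log\delta^{-1}}$, $L_1=\sqrt{\log\delta^{-1}}$, $L_2=\frac{\log\delta^{-1}\,\log\log\delta^{-1}}n$, $L_3=(\log\delta^{-1})^2$, $\beta(t,\delta)=\log\big(\log(1/\delta)\,t^\alpha/\delta\big)$. For every bandit instance $\mu$ as above there is $\delta_0>0$ such that for all $\delta\in(0,\delta_0)$: the probability that Tri-BBAI returns in Stage III an arm other than arm $1$ is at most $\delta/2$;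 the probability that it reaches Stage IV and returns there an arm other than arm $1$ is at most $\delta/2$; hence it returns a wrong arm with probability at most $\delta$. -/

import Mathlib

open MeasureTheory ProbabilityTheory Set Filter Topology
open scoped ENNReal

namespace TriBBAI

/-! ### One-parameter exponential families, parametrised by their means -/

/-- The member `ν_θ` of the exponential family with base measure `ρ`: it has density
`x ↦ exp (x θ - b(θ))` with respect to `ρ`, where `b(θ) = log ∫ exp (x θ) dρ(x)`. -/
noncomputable def expFam (ρ : Measure ℝ) (θ : ℝ) : Measure ℝ :=
  ρ.withDensity fun x => ENNReal.ofReal (Real.exp (x * θ - cgf id ρ θ))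

/-- The parameter space: the interior of the set of all `θ` with `∫ exp (x θ) dρ(x) < ∞`. -/
def paramSpace (ρ : Measure ℝ) : Set ℝ :=
  interior (integrableExpSet id ρ)

/-- The mean of `ν_θ`. -/
noncomputable def famMean (ρ : Measure ℝ) (θ : ℝ) : ℝ :=
  ∫ x, x ∂(expFam ρ θ)

/-- The set of all mean values of the family. -/
def meanSpace (ρ : Measure ℝ) : Set ℝ :=
  famMean ρ '' paramSpace ρ

/-- The member of the family with mean value `m` (meaningful for `m ∈ meanSpace ρ`). -/
noncomputable def armLaw (ρ : Measure ℝ) (m : ℝ) : Measure ℝ :=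
  expFam ρ (Function.invFunOn (famMean ρ) (paramSpace ρ) m)

open Classical in
/-- `d(x, y)`, the Kullback-Leibler divergence between the members of the family with means `x` and
`y`. An empirical mean can lie on the boundary of the set of mean values (for instance `0` or `1`
for Bernoulli rewards); there `d` is extended by lower semicontinuity. -/
noncomputable def kl (ρ : Measure ℝ) (x y : ℝ) : ℝ≥0∞ :=
  if x ∈ meanSpace ρ ∧ y ∈ meanSpace ρ then
    InformationTheory.klDiv (armLaw ρ x) (armLaw ρ y)
  else
    liminf (fun p : ℝ × ℝ => InformationTheory.klDiv (armLaw ρ p.1) (armLaw ρ p.2))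
      (𝓝[meanSpace ρ ×ˢ meanSpace ρ] (x, y))

/-! ### Characteristic time and optimal allocation -/

variable {n : ℕ}

/-- Bandit instances whose (unique) best arm is not `k`. -/
def Alt (ρ : Measure ℝ) (k : Fin n) : Set (Fin n → ℝ) :=
  {l | (∀ i, l i ∈ meanSpace ρ) ∧ ∃ j, j ≠ k ∧ ∀ i, i ≠ j → l i < l j}

/-- `inf_{λ ∈ Alt} ∑ i, w_i d(b_i, λ_i)`, where `k` is the index of the best arm of `b`. -/
noncomputable def altRate (ρ : Measure ℝ) (k : Fin n) (b w : Fin n → ℝ) : ℝ≥0∞ :=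
  ⨅ l ∈ Alt ρ k, ∑ i, ENNReal.ofReal (w i) * kl ρ (b i) (l i)

/-- The characteristic time `T^*(b)`, where `k` is the index of the best arm of `b`. -/
noncomputable def charTime (ρ : Measure ℝ) (k : Fin n) (b : Fin n → ℝ) : ℝ≥0∞ :=
  (⨆ w ∈ stdSimplex ℝ (Fin n), altRate ρ k b w)⁻¹

/-- The set of optimal allocations:
`argmax_{w in the simplex} inf_{λ ∈ Alt} ∑ i, w_i d(b_i, λ_i)`. -/
def optAlloc (ρ : Measure ℝ) (k : Fin n) (b : Fin n → ℝ) : Set (Fin n → ℝ) :=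
  {w | w ∈ stdSimplex ℝ (Fin n) ∧ ∀ v ∈ stdSimplex ℝ (Fin n), altRate ρ k b v ≤ altRate ρ k b w}

/-- `alloc k b` is a version of `w^*(b)` (`k` being the index of the best arm of `b`): a vector of
the simplex, which belongs to the argmax whenever the argmax is not empty. -/
def IsAllocRule (ρ : Measure ℝ) (alloc : Fin n → (Fin n → ℝ) → (Fin n → ℝ)) : Prop :=
  ∀ k b, alloc k b ∈ stdSimplex ℝ (Fin n) ∧
    ((optAlloc ρ k b).Nonempty → alloc k b ∈ optAlloc ρ k b)

/-- `sel v` is an index of a largest entry of `v` (with any way of breaking ties). -/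
def IsArgmaxRule (sel : (Fin n → ℝ) → Fin n) : Prop :=
  ∀ (v : Fin n → ℝ) (i : Fin n), v i ≤ v (sel v)

/-! ### The algorithm -/

/-- Input parameters of the algorithm. -/
structure Params where
  /-- shift of the empirical means in Stage II -/
  ε : ℝ
  /-- confidence parameter -/
  δ : ℝ
  /-- number of pulls of each arm in Stage I -/
  L₁ : ℝ
  /-- cap on the number of pulls of each arm in Stage II -/
  L₂ : ℝ
  /-- number of pulls of each arm at the end of Stage IV -/
  L₃ : ℝ
  /-- oversampling factor -/
  α : ℝ
  /-- threshold function of the stopping rule -/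
  β : ℝ → ℝ → ℝ

/-- Empirical means after `N i` pulls of each arm `i`; `x i s` is the reward obtained at the
pull number `s + 1` of arm `i`. -/
noncomputable def empMean (x : Fin n → ℕ → ℝ) (N : Fin n → ℕ) (i : Fin n) : ℝ :=
  (∑ s ∈ Finset.range (N i), x i s) / N i

open Classical in
/-- The vector `b^q` built from the empirical means `m` whose largest entry has index `k`. -/
noncomputable def shifted (ε : ℝ) (k : Fin n) (m : Fin n → ℝ) (i : Fin n) : ℝ :=
  if i = k then m i - ε else m i + ε

/-- `T_i^q = min {α w^*_i(b^q) T^*(b^q) log (1/δ), L₂}`, rounded up to an integer; here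
`w = w^*(b^q)` and `T = T^*(b^q)`. -/
noncomputable def target (p : Params) (w : Fin n → ℝ) (T : ℝ≥0∞) (i : Fin n) : ℕ :=
  ⌈(min (ENNReal.ofReal p.α * ENNReal.ofReal (w i) * T * ENNReal.ofReal (Real.log p.δ⁻¹))
      (ENNReal.ofReal p.L₂)).toReal⌉₊

/-- Numbers of pulls of the arms at the end of Stage I. -/
noncomputable def stageOne (p : Params) : Fin n → ℕ :=
  fun _ => ⌈p.L₁⌉₊

open Classical in
/-- Stage II with at most `fuel` further batches, started after `N i = max_{r < q} T_i^r` pulls of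
each arm `i` and with `wPrev = w^*(b^{q-1})`. The value is the vector of the numbers of pulls at
time `τ`. -/
noncomputable def stageTwo (ρ : Measure ℝ) (p : Params) (sel : (Fin n → ℝ) → Fin n)
    (alloc : Fin n → (Fin n → ℝ) → (Fin n → ℝ)) (x : Fin n → ℕ → ℝ) :
    (fuel : ℕ) → (N : Fin n → ℕ) → (wPrev : Fin n → ℝ) → (Fin n → ℕ)
  | 0, N, _ => N
  | fuel + 1, N, wPrev =>
    let m := empMean x N
    let k := sel m
    let b := shifted p.ε k m
    let w := alloc k b
    let N' : Fin n → ℕ := fun i => max (N i) (target p w (charTime ρ k b) i)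
    if ∀ i, |w i - wPrev i| ≤ 1 / Real.sqrt n then N'
    else stageTwo ρ p sel alloc x fuel N' w

/-- Numbers of pulls of the arms at time `τ`, the end of Stage II, which has at most `log (1/δ)`
batches and starts from the uniform allocation `w^*(b^0)`. -/
noncomputable def pullsTau (ρ : Measure ℝ) (p : Params) (sel : (Fin n → ℝ) → Fin n)
    (alloc : Fin n → (Fin n → ℝ) → (Fin n → ℝ)) (x : Fin n → ℕ → ℝ) : Fin n → ℕ :=
  stageTwo ρ p sel alloc x ⌊Real.log (1 / p.δ)⌋₊ (stageOne p) (fun _ => 1 / n)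

/-- The weighted empirical mean of the arms `i` and `j`. -/
noncomputable def pairMean (x : Fin n → ℕ → ℝ) (N : Fin n → ℕ) (i j : Fin n) : ℝ :=
  N i * empMean x N i / (N i + N j) + N j * empMean x N j / (N i + N j)

/-- The statistic `Z_{ij}`. -/
noncomputable def chernoffZ (ρ : Measure ℝ) (x : Fin n → ℕ → ℝ) (N : Fin n → ℕ)
    (i j : Fin n) : ℝ≥0∞ :=
  kl ρ (empMean x N i) (pairMean x N i j) * N i + kl ρ (empMean x N j) (pairMean x N i j) * N j

/-- The arm with the largest empirical mean at time `τ`. -/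
noncomputable def armTau (ρ : Measure ℝ) (p : Params) (sel : (Fin n → ℝ) → Fin n)
    (alloc : Fin n → (Fin n → ℝ) → (Fin n → ℝ)) (x : Fin n → ℕ → ℝ) : Fin n :=
  sel (empMean x (pullsTau ρ p sel alloc x))

/-- Stage III: Chernoff's stopping condition `min_{j ≠ i^*(τ)} Z_j(τ) ≥ β(τ, δ/2)`, where `τ` is the
total number of pulls made so far. -/
def ChernoffStop (ρ : Measure ℝ) (p : Params) (sel : (Fin n → ℝ) → Fin n)
    (alloc : Fin n → (Fin n → ℝ) → (Fin n → ℝ)) (x : Fin n → ℕ → ℝ) : Prop :=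
  ∀ j, j ≠ armTau ρ p sel alloc x →
    ENNReal.ofReal (p.β ((∑ i, pullsTau ρ p sel alloc x i : ℕ) : ℝ) (p.δ / 2)) ≤
      chernoffZ ρ x (pullsTau ρ p sel alloc x) (armTau ρ p sel alloc x) j

/-- Numbers of pulls at the end of Stage IV: each arm is pulled until it has `L₃` pulls in total. -/
noncomputable def pullsFinal (ρ : Measure ℝ) (p : Params) (sel : (Fin n → ℝ) → Fin n)
    (alloc : Fin n → (Fin n → ℝ) → (Fin n → ℝ)) (x : Fin n → ℕ → ℝ) (i : Fin n) : ℕ :=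
  max (pullsTau ρ p sel alloc x i) ⌈p.L₃⌉₊

open Classical in
/-- The arm returned by Tri-BBAI on the reward table `x`. -/
noncomputable def output (ρ : Measure ℝ) (p : Params) (sel : (Fin n → ℝ) → Fin n)
    (alloc : Fin n → (Fin n → ℝ) → (Fin n → ℝ)) (x : Fin n → ℕ → ℝ) : Fin n :=
  if ChernoffStop ρ p sel alloc x then armTau ρ p sel alloc x
  else sel (empMean x (pullsFinal ρ p sel alloc x))

/-- The choice of the parameters for `n` arms, as functions of `α` and `δ`. -/
noncomputable def asymParams (n : ℕ) (α δ : ℝ) : Params where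
  ε := 1 / Real.log (Real.log δ⁻¹)
  δ := δ
  L₁ := Real.sqrt (Real.log δ⁻¹)
  L₂ := Real.log δ⁻¹ * Real.log (Real.log δ⁻¹) / n
  L₃ := Real.log δ⁻¹ ^ 2
  α := α
  β := fun t η => Real.log (Real.log (1 / η) * t ^ α / η)

end TriBBAI

namespace TriBBAI

/-! ### Exponential families -/

section ExpFam

variable {ρ : Measure ℝ} {θ θ₀ : ℝ}

/-! Write L for log(1/δ). At empirical mean u, `gain ρ θ₀ θ u` is the log-likelihood ratio per
observation of θ against θ₀, and `rate ρ θ₀ u` is its supremum over θ. Chernoff's inequality shows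
that, for N samples from θ₀, the quantity N · rate has tail at most 2e^{-k} (`measure_le_average`);
for two independent arms the sum of two such quantities has tail at most 4(y + 1)e^{1-y}.

A wrong return in Stage III means that some suboptimal arm i is empirically at least as good as the
best arm and that Z ≥ log(2/δ). Bounding Z by the total deviation of the two arms and summing over
all sample sizes would only give δ times a polynomial in L. The improvement is `kl_add_kl_le`:
because the empirical order contradicts the true order, the total deviation exceeds Z by at least c
· r, where r bounds both sample sizes below and c depends only on the instance. Stage I forces r ≥
√L, and the extra factor e^{-c√L} beats every polynomial in L. A crude union bound over pairs of
sample sizes up to ⌈L₃⌉ therefore suffices. All that matters about the adaptive stage is that its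
pull counts stay in [⌈L₁⌉, ⌈L₃⌉].

In Stage IV every arm ends with exactly ⌈L₃⌉ pulls, so the sample size is deterministic. A reversed
order then forces rate ≥ c for one of two arms, which has probability of order e^{-cL²}, far below δ
= e^{-L}.

The constant c comes from `exists_separated`, which rests on the strict convexity of the
log-partition function between two parameters with different means. -/

theorem integrable_exp_of_mem_paramSpace (h : θ ∈ paramSpace ρ) :
    Integrable (fun x => Real.exp (θ * x)) ρ :=
  interior_subset (s := integrableExpSet id ρ) h

theorem expFam_eq_tilted [NeZero ρ] (h : θ ∈ paramSpace ρ) :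
    expFam ρ θ = ρ.tilted (fun x => θ * x) := by
  have h' := integrable_exp_of_mem_paramSpace h
  have h2 : Real.exp (cgf id ρ θ) = ∫ x, Real.exp (θ * x) ∂ρ := by
    rw [exp_cgf (X := id) h']; rfl
  unfold expFam Measure.tilted
  congr 1
  ext x
  rw [Real.exp_sub, h2, mul_comm]

theorem isProbabilityMeasure_expFam [NeZero ρ] (h : θ ∈ paramSpace ρ) :
    IsProbabilityMeasure (expFam ρ θ) := by
  rw [expFam_eq_tilted h]
  exact isProbabilityMeasure_tilted (integrable_exp_of_mem_paramSpace h)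

theorem famMean_eq_deriv [NeZero ρ] (h : θ ∈ paramSpace ρ) :
    famMean ρ θ = deriv (cgf id ρ) θ := by
  rw [famMean, expFam_eq_tilted h]
  exact integral_tilted_mul_self (X := id) h

theorem integrable_id_expFam [NeZero ρ] (h : θ ∈ paramSpace ρ) :
    Integrable (fun x => x) (expFam ρ θ) := by
  rw [expFam_eq_tilted h]
  exact (memLp_tilted_mul (X := id) h 1).integrable (by simp)

/-- The mean log-likelihood ratio of `ν_θ` against `ν_θ₀`, for observations with empirical
mean `u`. -/
noncomputable def gain (ρ : Measure ℝ) (θ₀ θ u : ℝ) : ℝ :=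
  (θ - θ₀) * u - cgf id ρ θ + cgf id ρ θ₀

theorem gain_self (θ u : ℝ) : gain ρ θ θ u = 0 := by simp [gain]

theorem gain_symm (θ θ₀ u : ℝ) : gain ρ θ θ₀ u = - gain ρ θ₀ θ u := by
  simp only [gain]; ring

/-- Cocycle identity for log-likelihood ratios: it allows the reference parameter to be changed. -/
theorem gain_add_gain (θ θ₀ θ₁ u : ℝ) :
    gain ρ θ₀ θ₁ u + gain ρ θ₁ θ u = gain ρ θ₀ θ u := by
  simp only [gain]; ring

theorem gain_mono_of_le {u v : ℝ} (h : θ₀ ≤ θ) (huv : u ≤ v) :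
    gain ρ θ₀ θ u ≤ gain ρ θ₀ θ v := by
  have := mul_le_mul_of_nonneg_left huv (sub_nonneg.2 h)
  simp only [gain]; linarith

theorem gain_anti_of_le {u v : ℝ} (h : θ ≤ θ₀) (huv : u ≤ v) :
    gain ρ θ₀ θ v ≤ gain ρ θ₀ θ u := by
  have := mul_le_mul_of_nonneg_left huv (sub_nonneg.2 h)
  simp only [gain]; linarith

theorem expFam_eq_tilted_expFam [NeZero ρ] (h₀ : θ₀ ∈ paramSpace ρ) (h : θ ∈ paramSpace ρ) :
    expFam ρ θ = (expFam ρ θ₀).tilted (fun x => (θ - θ₀) * x) := by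
  rw [expFam_eq_tilted h, expFam_eq_tilted h₀,
    tilted_tilted (integrable_exp_of_mem_paramSpace h₀)]
  congr 1
  ext x
  simp only [Pi.add_apply]; ring

theorem integrable_exp_expFam [NeZero ρ] (h₀ : θ₀ ∈ paramSpace ρ) (h : θ ∈ paramSpace ρ) :
    Integrable (fun x => Real.exp ((θ - θ₀) * x)) (expFam ρ θ₀) := by
  rw [expFam_eq_tilted h₀, integrable_tilted_iff (integrable_exp_of_mem_paramSpace h₀)]
  refine (integrable_exp_of_mem_paramSpace h).congr (.of_forall fun x => ?_)
  simp only [smul_eq_mul, ← Real.exp_add]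
  congr 1; ring

theorem cgf_expFam [NeZero ρ] (h₀ : θ₀ ∈ paramSpace ρ) (h : θ ∈ paramSpace ρ) :
    cgf id (expFam ρ θ₀) (θ - θ₀) = cgf id ρ θ - cgf id ρ θ₀ := by
  have h1 : mgf id (expFam ρ θ₀) (θ - θ₀) = mgf id ρ θ / mgf id ρ θ₀ := by
    rw [expFam_eq_tilted h₀]
    simp only [mgf, id_eq]
    rw [integral_exp_tilted]
    congr 2
    ext x
    simp only [Pi.add_apply]; congr 1; ring
  rw [cgf, h1, Real.log_div]
  · rfl
  · exact (mgf_pos' (NeZero.ne ρ) (integrable_exp_of_mem_paramSpace h)).ne'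
  · exact (mgf_pos' (NeZero.ne ρ) (integrable_exp_of_mem_paramSpace h₀)).ne'

theorem llr_expFam [NeZero ρ] (h₀ : θ₀ ∈ paramSpace ρ) (h : θ ∈ paramSpace ρ) :
    llr (expFam ρ θ) (expFam ρ θ₀) =ᵐ[expFam ρ θ] gain ρ θ₀ θ := by
  have := isProbabilityMeasure_expFam h₀
  have h1 := log_rnDeriv_tilted_left_self (integrable_exp_expFam h₀ h)
  rw [← expFam_eq_tilted_expFam h₀ h] at h1
  have hac : expFam ρ θ ≪ expFam ρ θ₀ := by
    rw [expFam_eq_tilted_expFam h₀ h]; exact tilted_absolutelyContinuous _ _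
  filter_upwards [hac.ae_le h1] with x hx
  rw [llr, hx]
  have := cgf_expFam h₀ h
  simp only [cgf, mgf, id_eq] at this
  rw [this]; simp only [gain, cgf, mgf, id_eq]; ring

theorem integrable_gain [NeZero ρ] (θ₀ : ℝ) (h : θ ∈ paramSpace ρ) :
    Integrable (gain ρ θ₀ θ) (expFam ρ θ) := by
  have := isProbabilityMeasure_expFam h
  exact (((integrable_id_expFam h).const_mul (θ - θ₀)).sub (integrable_const _)).add
    (integrable_const _)

theorem integral_gain [NeZero ρ] (θ₀ : ℝ) (h : θ ∈ paramSpace ρ) :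
    ∫ x, gain ρ θ₀ θ x ∂(expFam ρ θ) = gain ρ θ₀ θ (famMean ρ θ) := by
  have := isProbabilityMeasure_expFam h
  have h1 := (integrable_id_expFam h).const_mul (θ - θ₀)
  have h2 : Integrable (fun x => (θ - θ₀) * x - cgf id ρ θ) (expFam ρ θ) :=
    h1.sub (integrable_const _)
  simp only [gain]
  rw [integral_add h2 (integrable_const _), integral_sub h1 (integrable_const _),
    integral_const_mul]
  simp [famMean]

theorem klDiv_expFam [NeZero ρ] (h₀ : θ₀ ∈ paramSpace ρ) (h : θ ∈ paramSpace ρ) :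
    InformationTheory.klDiv (expFam ρ θ) (expFam ρ θ₀) =
      ENNReal.ofReal (gain ρ θ₀ θ (famMean ρ θ)) := by
  have := isProbabilityMeasure_expFam h
  have := isProbabilityMeasure_expFam h₀
  have hl := llr_expFam h₀ h
  have hac : expFam ρ θ ≪ expFam ρ θ₀ := by
    rw [expFam_eq_tilted_expFam h₀ h]; exact tilted_absolutelyContinuous _ _
  rw [InformationTheory.klDiv_of_ac_of_integrable hac
    ((integrable_gain θ₀ h).congr hl.symm), integral_congr_ae hl, integral_gain θ₀ h]
  simp

/-- The expected log-likelihood ratio is a Kullback–Leibler divergence; equivalently, the likelihood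
at mean value m is maximised by the member with mean m. -/
theorem gain_famMean_nonneg [NeZero ρ] (h₀ : θ₀ ∈ paramSpace ρ) (h : θ ∈ paramSpace ρ) :
    0 ≤ gain ρ θ₀ θ (famMean ρ θ) := by
  have := isProbabilityMeasure_expFam h
  have := isProbabilityMeasure_expFam h₀
  have hl := llr_expFam h₀ h
  have hac : expFam ρ θ ≪ expFam ρ θ₀ := by
    rw [expFam_eq_tilted_expFam h₀ h]; exact tilted_absolutelyContinuous _ _
  have := InformationTheory.integral_llr_add_sub_measure_univ_nonneg hac
    ((integrable_gain θ₀ h).congr hl.symm)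
  rw [integral_congr_ae hl, integral_gain θ₀ h] at this
  simpa using this

theorem gain_famMean_nonpos [NeZero ρ] (h₀ : θ₀ ∈ paramSpace ρ) (h : θ ∈ paramSpace ρ) :
    gain ρ θ₀ θ (famMean ρ θ₀) ≤ 0 := by
  rw [gain_symm]; linarith [gain_famMean_nonneg h h₀]

/-- The two divergences add up to (θ - θ₀) times the difference of the means, so this product is
nonnegative. -/
theorem lt_of_famMean_lt [NeZero ρ] (h₀ : θ₀ ∈ paramSpace ρ) (h : θ ∈ paramSpace ρ)
    (hlt : famMean ρ θ₀ < famMean ρ θ) : θ₀ < θ := by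
  have h1 := gain_famMean_nonneg h₀ h
  have h2 := gain_famMean_nonpos h₀ h
  by_contra! hle
  rcases hle.lt_or_eq with h3 | h3
  · have := mul_lt_mul_of_pos_left hlt (sub_pos.2 h3)
    simp only [gain] at h1 h2
    linarith
  · simp [h3] at hlt

/-! ### The interval of mean values. -/

theorem convex_paramSpace : Convex ℝ (paramSpace ρ) := convex_integrableExpSet.interior

theorem ordConnected_meanSpace [NeZero ρ] : (meanSpace ρ).OrdConnected := by
  have h1 : IsPreconnected (paramSpace ρ) := convex_paramSpace.isPreconnected
  have h2 : ContinuousOn (famMean ρ) (paramSpace ρ) := by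
    have h3 : ContinuousOn (deriv (cgf id ρ)) (paramSpace ρ) :=
      (analyticOnNhd_cgf (X := id) (μ := ρ)).deriv.continuousOn
    exact h3.congr fun θ hθ => famMean_eq_deriv hθ
  exact (h1.image _ h2).ordConnected

/-- The natural parameter of the member of the family with mean value `m`. -/
noncomputable def natParam (ρ : Measure ℝ) (m : ℝ) : ℝ :=
  Function.invFunOn (famMean ρ) (paramSpace ρ) m

theorem natParam_mem {m : ℝ} (hm : m ∈ meanSpace ρ) : natParam ρ m ∈ paramSpace ρ :=
  Function.invFunOn_mem hm

theorem famMean_natParam {m : ℝ} (hm : m ∈ meanSpace ρ) : famMean ρ (natParam ρ m) = m :=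
  Function.invFunOn_eq hm

theorem armLaw_eq (m : ℝ) : armLaw ρ m = expFam ρ (natParam ρ m) := rfl

/-- The Legendre transform of the cumulant generating function of `ν_θ₀`. -/
noncomputable def rate (ρ : Measure ℝ) (θ₀ u : ℝ) : ℝ≥0∞ :=
  ⨆ θ ∈ paramSpace ρ, ENNReal.ofReal (gain ρ θ₀ θ u)

theorem ofReal_gain_le_rate (h : θ ∈ paramSpace ρ) (u : ℝ) :
    ENNReal.ofReal (gain ρ θ₀ θ u) ≤ rate ρ θ₀ u :=
  le_iSup₂ (f := fun θ _ => ENNReal.ofReal (gain ρ θ₀ θ u)) θ h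

theorem continuous_gain (θ₀ θ : ℝ) : Continuous (gain ρ θ₀ θ) := by
  unfold gain; fun_prop

theorem measurable_rate (θ₀ : ℝ) : Measurable (rate ρ θ₀) := by
  apply LowerSemicontinuous.measurable
  unfold rate
  exact lowerSemicontinuous_biSup fun θ _ =>
    (ENNReal.continuous_ofReal.comp (continuous_gain θ₀ θ)).lowerSemicontinuous

theorem klDiv_armLaw [NeZero ρ] {x y : ℝ} (hx : x ∈ meanSpace ρ) (hy : y ∈ meanSpace ρ) :
    InformationTheory.klDiv (armLaw ρ x) (armLaw ρ y) =
      ENNReal.ofReal (gain ρ (natParam ρ y) (natParam ρ x) x) := by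
  rw [armLaw_eq, armLaw_eq, klDiv_expFam (natParam_mem hy) (natParam_mem hx), famMean_natParam hx]

theorem klDiv_armLaw_le_rate [NeZero ρ] {x y : ℝ} (hx : x ∈ meanSpace ρ)
    (hy : y ∈ meanSpace ρ) :
    InformationTheory.klDiv (armLaw ρ x) (armLaw ρ y) ≤ rate ρ (natParam ρ y) x := by
  rw [klDiv_armLaw hx hy]
  exact ofReal_gain_le_rate (natParam_mem hx) x

/-- Each gain is affine in the empirical mean and nonpositive at `w`, so moving towards `w` cannot
increase its positive part. -/
theorem rate_lineMap_le [NeZero ρ] {u w s : ℝ} (hw : w ∈ meanSpace ρ) (hs : s ∈ Icc (0 : ℝ) 1) :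
    rate ρ (natParam ρ w) ((1 - s) * u + s * w) ≤ rate ρ (natParam ρ w) u := by
  refine iSup₂_le fun θ hθ => ?_
  refine le_trans ?_ (ofReal_gain_le_rate hθ u)
  have h1 := gain_famMean_nonpos (natParam_mem hw) hθ
  rw [famMean_natParam hw] at h1
  have h2 : gain ρ (natParam ρ w) θ ((1 - s) * u + s * w) =
      (1 - s) * gain ρ (natParam ρ w) θ u + s * gain ρ (natParam ρ w) θ w := by
    simp only [gain]; ring
  rcases le_total 0 (gain ρ (natParam ρ w) θ u) with h3 | h3
  · apply ENNReal.ofReal_le_ofReal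
    rw [h2]; nlinarith [hs.1, hs.2]
  · rw [ENNReal.ofReal_of_nonpos]
    · exact zero_le
    · rw [h2]; nlinarith [hs.1, hs.2]

/-! ### Control of the divergence up to the boundary of the mean space. -/

theorem mem_of_mem_Ioo_of_mem_closure {s : Set ℝ} (hs : s.OrdConnected) {u v x : ℝ}
    (hu : u ∈ closure s) (hv : v ∈ closure s) (hx : x ∈ Ioo v u) : x ∈ s := by
  obtain ⟨a, ha, has⟩ := mem_closure_iff.1 hv (Iio x) isOpen_Iio hx.1
  obtain ⟨b, hb, hbs⟩ := mem_closure_iff.1 hu (Ioi x) isOpen_Ioi hx.2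
  exact hs.out has hbs ⟨le_of_lt ha, le_of_lt hb⟩

theorem mem_of_mem_segment_closure {s : Set ℝ} (hs : s.OrdConnected) {u w t : ℝ}
    (hu : u ∈ closure s) (hw : w ∈ s) (ht : t ∈ Ioc (0 : ℝ) 1) : (1 - t) * u + t * w ∈ s := by
  rcases ht.2.eq_or_lt with h1 | h1
  · simpa [h1] using hw
  rcases lt_trichotomy u w with h | h | h
  · exact mem_of_mem_Ioo_of_mem_closure hs (subset_closure hw) hu
      ⟨by nlinarith [ht.1], by nlinarith [ht.1]⟩
  · convert! hw using 1; rw [h]; ring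
  · exact mem_of_mem_Ioo_of_mem_closure hs hu (subset_closure hw)
      ⟨by nlinarith [ht.1], by nlinarith [ht.1]⟩

/-- At a boundary point `u` the liminf is tested along the segment from `u` to `w`, which lies in
the mean space except perhaps at `u`; there each divergence is below the rate at its first argument,
hence below the rate at `u`. -/
theorem kl_le_rate [NeZero ρ] {u w : ℝ} (hu : u ∈ closure (meanSpace ρ)) (hw : w ∈ meanSpace ρ) :
    kl ρ u w ≤ rate ρ (natParam ρ w) u := by
  unfold kl
  split_ifs with h
  · exact klDiv_armLaw_le_rate h.1 h.2
  · refine liminf_le_of_frequently_le' ?_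
    have ht : Tendsto (fun t : ℝ => ((1 - t) * u + t * w, w)) (𝓝[>] 0)
        (𝓝[meanSpace ρ ×ˢ meanSpace ρ] (u, w)) := by
      refine tendsto_nhdsWithin_iff.2 ⟨?_, ?_⟩
      · have : Continuous fun t : ℝ => ((1 - t) * u + t * w, w) := by fun_prop
        have h2 := this.tendsto 0
        simp only [sub_zero, one_mul, zero_mul, add_zero] at h2
        exact h2.mono_left nhdsWithin_le_nhds
      · filter_upwards [Ioc_mem_nhdsGT (zero_lt_one' ℝ)] with t ht
        exact ⟨mem_of_mem_segment_closure ordConnected_meanSpace hu hw ht, hw⟩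
    refine ht.frequently (Eventually.frequently ?_)
    filter_upwards [Ioc_mem_nhdsGT (zero_lt_one' ℝ)] with t ht
    exact (klDiv_armLaw_le_rate
      (mem_of_mem_segment_closure ordConnected_meanSpace hu hw ht) hw).trans
      (rate_lineMap_le hw ⟨ht.1.le, ht.2⟩)

theorem kl_self [NeZero ρ] {u : ℝ} (hu : u ∈ closure (meanSpace ρ)) : kl ρ u u = 0 := by
  have h0 : ∀ x ∈ meanSpace ρ, InformationTheory.klDiv (armLaw ρ x) (armLaw ρ x) = 0 := by
    intro x hx
    rw [klDiv_armLaw hx hx, gain_self, ENNReal.ofReal_zero]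
  unfold kl
  split_ifs with h
  · exact h0 u h.1
  · refine le_antisymm (liminf_le_of_frequently_le' ?_) zero_le
    have : (𝓝[meanSpace ρ] u).NeBot := mem_closure_iff_nhdsWithin_neBot.1 hu
    have ht : Tendsto (fun t : ℝ => (t, t)) (𝓝[meanSpace ρ] u)
        (𝓝[meanSpace ρ ×ˢ meanSpace ρ] (u, u)) := by
      refine tendsto_nhdsWithin_iff.2 ⟨?_, ?_⟩
      · exact ((by fun_prop : Continuous fun t : ℝ => (t, t)).tendsto u).mono_left
          nhdsWithin_le_nhds
      · filter_upwards [self_mem_nhdsWithin] with t ht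
        exact ⟨ht, ht⟩
    refine ht.frequently (Eventually.frequently ?_)
    filter_upwards [self_mem_nhdsWithin] with t ht
    exact (h0 t ht).le

end ExpFam

/-! ### Separation of two members of the family -/

section Separation

variable {ρ : Measure ℝ} {θ₁ θ₂ : ℝ}

/-- `Separated ρ θ₁ θ₂ c`: whenever `v ≤ u`, some member of the family explains `u` and `v` at least
as well as `θ₁` and `θ₂` do, and strictly better by the margin `c` for one of them. -/
def Separated (ρ : Measure ℝ) (θ₁ θ₂ c : ℝ) : Prop :=
  ∀ u v, v ≤ u → ∃ θ ∈ paramSpace ρ, 0 ≤ gain ρ θ₁ θ u ∧ 0 ≤ gain ρ θ₂ θ v ∧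
    (c ≤ gain ρ θ₁ θ u ∨ c ≤ gain ρ θ₂ θ v)

theorem hasDerivAt_cgf_famMean [NeZero ρ] {θ : ℝ} (h : θ ∈ paramSpace ρ) :
    HasDerivAt (cgf id ρ) (famMean ρ θ) θ := by
  rw [famMean_eq_deriv h]
  exact (analyticAt_cgf h).differentiableAt.hasDerivAt

theorem exists_gain_pos [NeZero ρ] (h₁ : θ₁ ∈ paramSpace ρ) (h₂ : θ₂ ∈ paramSpace ρ)
    (hlt : θ₁ < θ₂) (hm : famMean ρ θ₁ < famMean ρ θ₂) {m : ℝ}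
    (hmeq : (θ₂ - θ₁) * m = cgf id ρ θ₂ - cgf id ρ θ₁) :
    ∃ θ ∈ Ioo θ₁ θ₂, 0 < gain ρ θ₁ θ m := by
  -- As a function of θ the gain at `m` vanishes at both θ₁ and θ₂ and has derivative `m - famMean ρ
  -- θ`. It increases to the right of θ₁ if `m` exceeds the mean there; otherwise `m` is below the
  -- mean at θ₂, and the gain is positive just left of θ₂.
  rcases lt_or_ge (famMean ρ θ₁) m with h | h
  · have hd := (hasDerivAt_iff_tendsto_slope.1 (hasDerivAt_cgf_famMean h₁)).mono_left
      (nhdsGT_le_nhdsNE θ₁)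
    obtain ⟨θ, hs, hθ⟩ := ((hd.eventually_lt_const h).and (Ioo_mem_nhdsGT hlt)).exists
    refine ⟨θ, hθ, ?_⟩
    rw [slope_def_field, div_lt_iff₀ (sub_pos.2 hθ.1)] at hs
    simp only [gain]; linarith
  · have hd := (hasDerivAt_iff_tendsto_slope.1 (hasDerivAt_cgf_famMean h₂)).mono_left
      (nhdsLT_le_nhdsNE θ₂)
    obtain ⟨θ, hs, hθ⟩ := ((hd.eventually_const_lt (h.trans_lt hm)).and
      (Ioo_mem_nhdsLT hlt)).exists
    refine ⟨θ, hθ, ?_⟩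
    rw [slope_def_field, ← neg_div_neg_eq, lt_div_iff₀ (by linarith [hθ.2])] at hs
    simp only [gain]; linarith

theorem exists_separated [NeZero ρ] (h₁ : θ₁ ∈ paramSpace ρ) (h₂ : θ₂ ∈ paramSpace ρ)
    (hm : famMean ρ θ₁ < famMean ρ θ₂) : ∃ c, 0 < c ∧ Separated ρ θ₁ θ₂ c := by
  have hlt := lt_of_famMean_lt h₁ h₂ hm
  have hD : 0 < θ₂ - θ₁ := sub_pos.2 hlt
  -- `m` is the empirical mean at which θ₁ and θ₂ are equally likely, so the intermediate θ beats
  -- both by the same amount `h`.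
  obtain ⟨m, hmeq⟩ : ∃ m, (θ₂ - θ₁) * m = cgf id ρ θ₂ - cgf id ρ θ₁ :=
    ⟨(cgf id ρ θ₂ - cgf id ρ θ₁) / (θ₂ - θ₁), by field_simp⟩
  obtain ⟨θ, hθ, hpos⟩ := exists_gain_pos h₁ h₂ hlt hm hmeq
  set h := gain ρ θ₁ θ m with hh
  have hmem : θ ∈ paramSpace ρ :=
    convex_paramSpace.ordConnected.out h₁ h₂ ⟨hθ.1.le, hθ.2.le⟩
  have hη : (θ₂ - θ₁) * (h / (2 * (θ₂ - θ₁))) = h / 2 := by field_simp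
  -- Shifting the empirical mean by η changes any gain between parameters in [θ₁, θ₂] by at most `h
  -- / 2`. If u ≥ m + η take θ₂, if v ≤ m - η take θ₁; otherwise v ≤ u puts both within η of m and
  -- the intermediate θ works.
  set η := h / (2 * (θ₂ - θ₁))
  have hη0 : 0 ≤ η := by positivity
  refine ⟨h / 2, by positivity, fun u v huv => ?_⟩
  by_cases hu : m + η ≤ u
  · have h3 : h / 2 ≤ gain ρ θ₁ θ₂ u := by
      have := mul_le_mul_of_nonneg_left hu hD.le
      simp only [gain]; linarith
    exact ⟨θ₂, h₂, by linarith, (gain_self _ _).ge, .inl h3⟩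
  by_cases hv : v ≤ m - η
  · have h3 : h / 2 ≤ gain ρ θ₂ θ₁ v := by
      have := mul_le_mul_of_nonneg_left hv hD.le
      simp only [gain]; linarith
    exact ⟨θ₁, h₁, (gain_self _ _).ge, by linarith, .inr h3⟩
  push Not at hu hv
  have h3 : h / 2 ≤ gain ρ θ₁ θ u := by
    have e1 := mul_le_mul_of_nonneg_left (show m - η ≤ u by linarith) (sub_pos.2 hθ.1).le
    have e2 := mul_le_mul_of_nonneg_right (show θ - θ₁ ≤ θ₂ - θ₁ by linarith [hθ.2]) hη0
    simp only [gain] at hh ⊢; linarith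
  have h4 : h / 2 ≤ gain ρ θ₂ θ v := by
    have e1 := mul_le_mul_of_nonneg_left (show v ≤ m + η by linarith) (sub_pos.2 hθ.2).le
    have e2 := mul_le_mul_of_nonneg_right (show θ₂ - θ ≤ θ₂ - θ₁ by linarith [hθ.1]) hη0
    simp only [gain] at hh ⊢; linarith
  exact ⟨θ, hmem, by linarith, by linarith, .inl h3⟩

theorem Separated.mono {c c' : ℝ} (h : Separated ρ θ₁ θ₂ c) (hc : c' ≤ c) :
    Separated ρ θ₁ θ₂ c' := by
  intro u v huv
  obtain ⟨θ, hθ, h1, h2, h3⟩ := h u v huv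
  exact ⟨θ, hθ, h1, h2, h3.imp hc.trans hc.trans⟩

theorem Separated.le_rate {c : ℝ} (h : Separated ρ θ₁ θ₂ c) {u v : ℝ} (huv : v ≤ u) :
    ENNReal.ofReal c ≤ rate ρ θ₁ u ∨ ENNReal.ofReal c ≤ rate ρ θ₂ v := by
  obtain ⟨θ, hθ, -, -, h3⟩ := h u v huv
  exact h3.imp (fun h => (ENNReal.ofReal_le_ofReal h).trans (ofReal_gain_le_rate hθ u))
    (fun h => (ENNReal.ofReal_le_ofReal h).trans (ofReal_gain_le_rate hθ v))

/-- Changing the reference parameter shifts every gain by the same amount, hence also the supremum.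
The first conclusion keeps later sums of `ENNReal.ofReal` additive. -/
theorem rate_le_ofReal_sub {θ θ₀ u : ℝ} (hθ : θ ∈ paramSpace ρ) (hfin : rate ρ θ₀ u ≠ ∞) :
    0 ≤ (rate ρ θ₀ u).toReal - gain ρ θ₀ θ u ∧
      rate ρ θ u ≤ ENNReal.ofReal ((rate ρ θ₀ u).toReal - gain ρ θ₀ θ u) := by
  have key : ∀ θ' ∈ paramSpace ρ, gain ρ θ₀ θ' u ≤ (rate ρ θ₀ u).toReal := fun θ' hθ' =>
    (ENNReal.ofReal_le_iff_le_toReal hfin).1 (ofReal_gain_le_rate hθ' u)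
  refine ⟨sub_nonneg.2 (key θ hθ), iSup₂_le fun θ' hθ' => ENNReal.ofReal_le_ofReal ?_⟩
  have := gain_add_gain (ρ := ρ) θ' θ₀ θ u
  linarith [key θ' hθ']

/-- The transportation cost `Z` of two ordered empirical means is smaller than their total
deviation from the true parameters, with a margin proportional to the smaller sample size. -/
theorem kl_add_kl_le [NeZero ρ] {c : ℝ}
    (hc : 0 ≤ c) (hsep : Separated ρ θ₁ θ₂ c) {u v : ℝ} (hu : u ∈ closure (meanSpace ρ))
    (hv : v ∈ closure (meanSpace ρ)) (huv : v ≤ u) {a b r : ℕ} (ha : 0 < a) (hb : 0 < b)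
    (hra : r ≤ a) (hrb : r ≤ b) {w : ℝ} (hw : w = a * u / (a + b) + b * v / (a + b))
    (hne : kl ρ u w * a + kl ρ v w * b ≠ 0) :
    kl ρ u w * a + kl ρ v w * b + ENNReal.ofReal (c * r) ≤ a * rate ρ θ₁ u + b * rate ρ θ₂ v := by
  have ha' : (0 : ℝ) < a := by exact_mod_cast ha
  have hb' : (0 : ℝ) < b := by exact_mod_cast hb
  have hra' : (r : ℝ) ≤ a := by exact_mod_cast hra
  have hrb' : (r : ℝ) ≤ b := by exact_mod_cast hrb
  have hweq : (a + b) * w = a * u + b * v := by rw [hw]; field_simp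
  -- With equal means the pooled mean `w` may be a boundary point without a natural parameter, but
  -- then Z = 0, which `hne` excludes.
  rcases huv.eq_or_lt with rfl | hlt
  · have : w = v := by
      have : (a + b : ℝ) * w = (a + b) * v := by linarith
      exact mul_left_cancel₀ (by positivity) this
    simp [this, kl_self hv] at hne
  have hwI : w ∈ meanSpace ρ := by
    refine mem_of_mem_Ioo_of_mem_closure ordConnected_meanSpace hu hv ⟨?_, ?_⟩
    · by_contra! h
      nlinarith [mul_le_mul_of_nonneg_left h (by positivity : (0 : ℝ) ≤ a + b),
        mul_lt_mul_of_pos_left hlt ha']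
    · by_contra! h
      nlinarith [mul_le_mul_of_nonneg_left h (by positivity : (0 : ℝ) ≤ a + b),
        mul_lt_mul_of_pos_left hlt hb']
  set t := natParam ρ w
  have ht : t ∈ paramSpace ρ := natParam_mem hwI
  by_cases hf₁ : rate ρ θ₁ u = ∞
  · rw [hf₁, ENNReal.mul_top (by exact_mod_cast ha.ne'), top_add]; exact le_top
  by_cases hf₂ : rate ρ θ₂ v = ∞
  · rw [hf₂, ENNReal.mul_top (by exact_mod_cast hb.ne'), add_top]; exact le_top
  obtain ⟨p₁, q₁⟩ := rate_le_ofReal_sub ht hf₁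
  obtain ⟨p₂, q₂⟩ := rate_le_ofReal_sub ht hf₂
  -- `t` is the maximum-likelihood parameter of the pooled sample, so it explains the two samples
  -- together at least as well as the common θ provided by the separation.
  have hR : c * r ≤ a * gain ρ θ₁ t u + b * gain ρ θ₂ t v := by
    obtain ⟨θ, hθ, g1, g2, g3⟩ := hsep u v huv
    have e1 := gain_famMean_nonpos ht hθ
    rw [famMean_natParam hwI] at e1
    have e2 : c * r ≤ a * gain ρ θ₁ θ u + b * gain ρ θ₂ θ v := by
      rcases g3 with g3 | g3
      · have := mul_le_mul g3 hra' (by positivity) g1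
        have := mul_nonneg hb'.le g2
        linarith
      · have := mul_le_mul g3 hrb' (by positivity) g2
        have := mul_nonneg ha'.le g1
        linarith
    have e3 : a * gain ρ θ₁ θ u + b * gain ρ θ₂ θ v
        = a * gain ρ θ₁ t u + b * gain ρ θ₂ t v + (a + b) * gain ρ t θ w := by
      simp only [gain]
      linear_combination (t - θ) * hweq
    have := mul_nonpos_of_nonneg_of_nonpos (by positivity : (0 : ℝ) ≤ a + b) e1
    linarith
  have k₁ := (kl_le_rate hu hwI).trans q₁
  have k₂ := (kl_le_rate hv hwI).trans q₂
  calc kl ρ u w * a + kl ρ v w * b + ENNReal.ofReal (c * r)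
      ≤ ENNReal.ofReal ((rate ρ θ₁ u).toReal - gain ρ θ₁ t u) * a +
        ENNReal.ofReal ((rate ρ θ₂ v).toReal - gain ρ θ₂ t v) * b + ENNReal.ofReal (c * r) := by
        gcongr
    _ = ENNReal.ofReal (((rate ρ θ₁ u).toReal - gain ρ θ₁ t u) * a +
        ((rate ρ θ₂ v).toReal - gain ρ θ₂ t v) * b + c * r) := by
        rw [ENNReal.ofReal_add (by positivity) (by positivity),
          ENNReal.ofReal_add (by positivity) (by positivity), ENNReal.ofReal_mul p₁,
          ENNReal.ofReal_mul p₂, ENNReal.ofReal_natCast, ENNReal.ofReal_natCast]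
    _ ≤ ENNReal.ofReal (a * (rate ρ θ₁ u).toReal + b * (rate ρ θ₂ v).toReal) :=
        ENNReal.ofReal_le_ofReal (by linarith)
    _ = a * rate ρ θ₁ u + b * rate ρ θ₂ v := by
        rw [ENNReal.ofReal_add (by positivity) (by positivity), ENNReal.ofReal_mul (by positivity),
          ENNReal.ofReal_mul (by positivity), ENNReal.ofReal_natCast, ENNReal.ofReal_natCast,
          ENNReal.ofReal_toReal hf₁, ENNReal.ofReal_toReal hf₂]

end Separation

/-! ### Deviations of empirical means -/

section Deviations

variable {ρ : Measure ℝ} {θ θ₀ : ℝ}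

/-- An upper set may lack a least element; a compact subset has one, and inner regularity transfers
the bound on closed half-lines. -/
theorem measure_le_of_isUpperSet (m : Measure ℝ) [IsFiniteMeasure m] {S : Set ℝ}
    (hS : IsUpperSet S) {C : ℝ≥0∞} (hC : ∀ s ∈ S, m (Ici s) ≤ C) : m S ≤ C := by
  rw [hS.ordConnected.measurableSet.measure_eq_iSup_isCompact]
  refine iSup₂_le fun K hKS => iSup_le fun hK => ?_
  rcases K.eq_empty_or_nonempty with rfl | hne
  · simp
  · exact (measure_mono fun x hx => csInf_le hK.bddBelow hx).trans
      (hC _ (hKS (hK.sInf_mem hne)))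

theorem measure_le_of_isLowerSet (m : Measure ℝ) [IsFiniteMeasure m] {S : Set ℝ}
    (hS : IsLowerSet S) {C : ℝ≥0∞} (hC : ∀ s ∈ S, m (Iic s) ≤ C) : m S ≤ C := by
  rw [hS.ordConnected.measurableSet.measure_eq_iSup_isCompact]
  refine iSup₂_le fun K hKS => iSup_le fun hK => ?_
  rcases K.eq_empty_or_nonempty with rfl | hne
  · simp
  · exact (measure_mono fun x hx => le_csSup hK.bddAbove hx).trans
      (hC _ (hKS (hK.sSup_mem hne)))

theorem measure_le_mul_rate (m : Measure ℝ) [IsProbabilityMeasure m] (N : ℕ)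
    (hup : ∀ θ ∈ paramSpace ρ, θ₀ ≤ θ → ∀ u,
      m (Ici u) ≤ ENNReal.ofReal (Real.exp (-(N * gain ρ θ₀ θ u))))
    (hlo : ∀ θ ∈ paramSpace ρ, θ ≤ θ₀ → ∀ u,
      m (Iic u) ≤ ENNReal.ofReal (Real.exp (-(N * gain ρ θ₀ θ u)))) (k : ℝ) :
    m {u | ENNReal.ofReal k ≤ N * rate ρ θ₀ u} ≤ 2 * ENNReal.ofReal (Real.exp (-k)) := by
  rcases le_or_gt k 0 with hk | hk
  · have h1 : (1 : ℝ≥0∞) ≤ ENNReal.ofReal (Real.exp (-k)) := by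
      rw [ENNReal.one_le_ofReal]; exact Real.one_le_exp (by linarith)
    calc m _ ≤ 1 := prob_le_one
      _ ≤ 2 * ENNReal.ofReal (Real.exp (-k)) := by
        rw [two_mul]; exact h1.trans le_self_add
  -- The supremum in `rate` need not be attained, so the level is lowered to `k' < k` to obtain an
  -- actual θ; continuity recovers `k` at the end.
  have key : ∀ k' ∈ Ioo 0 k, m {u | ENNReal.ofReal k ≤ N * rate ρ θ₀ u} ≤
      2 * ENNReal.ofReal (Real.exp (-k')) := by
    intro k' hk'
    -- Gains are monotone in u, with direction given by the sign of θ - θ₀. The event thus splits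
    -- into an upper and a lower tail, and no union over θ is needed.
    have hsub : {u | ENNReal.ofReal k ≤ N * rate ρ θ₀ u} ⊆
        {u | ∃ θ ∈ paramSpace ρ, θ₀ ≤ θ ∧ k' < N * gain ρ θ₀ θ u} ∪
        {u | ∃ θ ∈ paramSpace ρ, θ ≤ θ₀ ∧ k' < N * gain ρ θ₀ θ u} := by
      intro u hu
      have h1 : ENNReal.ofReal k' < N * rate ρ θ₀ u :=
        ((ENNReal.ofReal_lt_ofReal_iff hk).2 hk'.2).trans_le hu
      rw [rate, ENNReal.mul_iSup] at h1
      obtain ⟨θ, h2⟩ := lt_iSup_iff.1 h1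
      rw [ENNReal.mul_iSup] at h2
      obtain ⟨hθ, h3⟩ := lt_iSup_iff.1 h2
      rw [← ENNReal.ofReal_natCast, ← ENNReal.ofReal_mul (Nat.cast_nonneg N),
        ENNReal.ofReal_lt_ofReal_iff_of_nonneg hk'.1.le] at h3
      exact (le_total θ₀ θ).imp (fun h => ⟨θ, hθ, h, h3⟩) (fun h => ⟨θ, hθ, h, h3⟩)
    refine (measure_mono hsub).trans ((measure_union_le _ _).trans ?_)
    rw [two_mul]
    gcongr
    · refine measure_le_of_isUpperSet m ?_ ?_
      · rintro u v huv ⟨θ, hθ, hle, hlt⟩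
        exact ⟨θ, hθ, hle, hlt.trans_le
          (mul_le_mul_of_nonneg_left (gain_mono_of_le hle huv) N.cast_nonneg)⟩
      · rintro u ⟨θ, hθ, hle, hlt⟩
        refine (hup θ hθ hle u).trans (ENNReal.ofReal_le_ofReal (Real.exp_le_exp.2 ?_))
        linarith
    · refine measure_le_of_isLowerSet m ?_ ?_
      · rintro u v huv ⟨θ, hθ, hle, hlt⟩
        exact ⟨θ, hθ, hle, hlt.trans_le
          (mul_le_mul_of_nonneg_left (gain_anti_of_le hle huv) N.cast_nonneg)⟩
      · rintro u ⟨θ, hθ, hle, hlt⟩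
        refine (hlo θ hθ hle u).trans (ENNReal.ofReal_le_ofReal (Real.exp_le_exp.2 ?_))
        linarith
  have hcont : Tendsto (fun k' : ℝ => 2 * ENNReal.ofReal (Real.exp (-k'))) (𝓝[<] k)
      (𝓝 (2 * ENNReal.ofReal (Real.exp (-k)))) := by
    have h1 : Continuous fun k' : ℝ => ENNReal.ofReal (Real.exp (-k')) :=
      ENNReal.continuous_ofReal.comp (by fun_prop)
    exact ((ENNReal.continuous_const_mul (by simp)).comp h1).tendsto k |>.mono_left
      nhdsWithin_le_nhds
  exact ge_of_tendsto hcont (by filter_upwards [Ioo_mem_nhdsLT hk] with k' hk' using key k' hk')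

/-! ### Chernoff bounds for averages of independent draws. -/

variable {Ω : Type*} [MeasurableSpace Ω] {P : Measure Ω} {Y : ℕ → Ω → ℝ}

theorem mgf_sum_expFam [NeZero ρ] (h₀ : θ₀ ∈ paramSpace ρ) (h : θ ∈ paramSpace ρ)
    (hlaw : ∀ s, HasLaw (Y s) (expFam ρ θ₀) P) (hind : iIndepFun Y P) (N : ℕ) :
    Integrable (fun ω => Real.exp ((θ - θ₀) * ∑ s ∈ Finset.range N, Y s ω)) P ∧
    mgf (fun ω => ∑ s ∈ Finset.range N, Y s ω) P (θ - θ₀) =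
      Real.exp (N * (cgf id ρ θ - cgf id ρ θ₀)) := by
  have := hind.isProbabilityMeasure
  have := isProbabilityMeasure_expFam h₀
  have hint := integrable_exp_expFam h₀ h
  have hm : ∀ s, mgf (Y s) P (θ - θ₀) = Real.exp (cgf id ρ θ - cgf id ρ θ₀) := by
    intro s
    rw [← mgf_id_map (hlaw s).aemeasurable, (hlaw s).map_eq, ← cgf_expFam h₀ h,
      exp_cgf (X := id) hint]
  have hsum : mgf (fun ω => ∑ s ∈ Finset.range N, Y s ω) P (θ - θ₀) =
      Real.exp (N * (cgf id ρ θ - cgf id ρ θ₀)) := by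
    have := hind.mgf_sum₀ (fun s => (hlaw s).aemeasurable) (Finset.range N) (t := θ - θ₀)
    rw [show (fun ω => ∑ s ∈ Finset.range N, Y s ω) = ∑ s ∈ Finset.range N, Y s by
      ext ω; simp, this, Finset.prod_congr rfl fun s _ => hm s]
    simp [← Real.exp_nat_mul]
  -- The `mgf` of a non-integrable exponential is 0 by convention, so its positivity yields
  -- integrability.
  refine ⟨mgf_pos_iff.1 ?_, hsum⟩
  rw [hsum]; exact Real.exp_pos _

theorem aemeasurable_average {ν : Measure ℝ} (hlaw : ∀ s, HasLaw (Y s) ν P) (N : ℕ) :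
    AEMeasurable (fun ω => (∑ s ∈ Finset.range N, Y s ω) / N) P :=
  (Finset.aemeasurable_fun_sum _ fun s _ => (hlaw s).aemeasurable).div_const _

theorem measure_le_average [NeZero ρ] (h₀ : θ₀ ∈ paramSpace ρ)
    (hlaw : ∀ s, HasLaw (Y s) (expFam ρ θ₀) P) (hind : iIndepFun Y P) {N : ℕ} (hN : 0 < N)
    (k : ℝ) :
    P {ω | ENNReal.ofReal k ≤ N * rate ρ θ₀ ((∑ s ∈ Finset.range N, Y s ω) / N)} ≤
      2 * ENNReal.ofReal (Real.exp (-k)) := by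
  have := hind.isProbabilityMeasure
  have hN' : (0 : ℝ) < N := by exact_mod_cast hN
  have hae := aemeasurable_average hlaw N
  have := Measure.isProbabilityMeasure_map hae
  have hmain := measure_le_mul_rate (ρ := ρ) (θ₀ := θ₀)
    (P.map fun ω => (∑ s ∈ Finset.range N, Y s ω) / N) N ?_ ?_ k
  · rwa [Measure.map_apply_of_aemeasurable hae
      (measurableSet_le measurable_const ((measurable_rate θ₀).const_mul _))] at hmain
  · intro θ hθ hle u
    rw [Measure.map_apply_of_aemeasurable hae measurableSet_Ici]
    obtain ⟨hi, hm⟩ := mgf_sum_expFam h₀ hθ hlaw hind N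
    have h1 := measure_ge_le_exp_mul_mgf (N * u) (sub_nonneg.2 hle) hi
    rw [hm, ← Real.exp_add] at h1
    refine ENNReal.le_ofReal_iff_toReal_le (measure_ne_top _ _) (Real.exp_nonneg _) |>.2 ?_
    refine (le_of_eq ?_).trans (h1.trans (le_of_eq ?_))
    · rw [measureReal_def]; congr 2; ext ω
      simp only [mem_preimage, mem_Ici, mem_ofPred_eq, le_div_iff₀ hN', mul_comm u]
    · congr 1; simp only [gain]; ring
  · intro θ hθ hle u
    rw [Measure.map_apply_of_aemeasurable hae measurableSet_Iic]
    obtain ⟨hi, hm⟩ := mgf_sum_expFam h₀ hθ hlaw hind N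
    have h1 := measure_le_le_exp_mul_mgf (N * u) (sub_nonpos.2 hle) hi
    rw [hm, ← Real.exp_add] at h1
    refine ENNReal.le_ofReal_iff_toReal_le (measure_ne_top _ _) (Real.exp_nonneg _) |>.2 ?_
    refine (le_of_eq ?_).trans (h1.trans (le_of_eq ?_))
    · rw [measureReal_def]; congr 2; ext ω
      simp only [mem_preimage, mem_Iic, mem_ofPred_eq, div_le_iff₀ hN', mul_comm u]
    · congr 1; simp only [gain]; ring

/-- Slice by k, the integer part of A capped at ⌊x⌋: then A ≥ k and B ≥ x - k - 1. Each slice has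
probability at most 4e^{1-x} by independence, and there are at most x + 1 slices. -/
theorem measure_ofReal_le_add {A B : Ω → ℝ≥0∞} [IsProbabilityMeasure P]
    (hAB : ∀ k l : ℝ, P ({ω | ENNReal.ofReal k ≤ A ω} ∩ {ω | ENNReal.ofReal l ≤ B ω}) =
      P {ω | ENNReal.ofReal k ≤ A ω} * P {ω | ENNReal.ofReal l ≤ B ω})
    (hA : ∀ k : ℝ, P {ω | ENNReal.ofReal k ≤ A ω} ≤ 2 * ENNReal.ofReal (Real.exp (-k)))
    (hB : ∀ k : ℝ, P {ω | ENNReal.ofReal k ≤ B ω} ≤ 2 * ENNReal.ofReal (Real.exp (-k)))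
    {x : ℝ} (hx : 0 ≤ x) :
    P {ω | ENNReal.ofReal x ≤ A ω + B ω} ≤
      ENNReal.ofReal ((x + 1) * (4 * Real.exp (1 - x))) := by
  have hsub : {ω | ENNReal.ofReal x ≤ A ω + B ω} ⊆ ⋃ k ∈ Finset.range (⌊x⌋₊ + 1),
      ({ω | ENNReal.ofReal k ≤ A ω} ∩ {ω | ENNReal.ofReal (x - k - 1) ≤ B ω}) := by
    intro ω hω
    simp only [mem_ofPred_eq] at hω
    simp only [mem_iUnion, Finset.mem_range, mem_inter_iff, mem_ofPred_eq, exists_prop]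
    by_cases h : ENNReal.ofReal x ≤ A ω
    · refine ⟨⌊x⌋₊, by omega, (ENNReal.ofReal_le_ofReal (Nat.floor_le hx)).trans h, ?_⟩
      rw [ENNReal.ofReal_of_nonpos (by linarith [Nat.lt_floor_add_one x])]
      exact zero_le
    · push Not at h
      obtain ⟨a, ha0, ha⟩ : ∃ a : ℝ, 0 ≤ a ∧ A ω = ENNReal.ofReal a :=
        ⟨(A ω).toReal, ENNReal.toReal_nonneg, (ENNReal.ofReal_toReal h.ne_top).symm⟩
      rw [ha] at h hω ⊢
      have hax : a < x := (ENNReal.ofReal_lt_ofReal_iff_of_nonneg ha0).1 h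
      refine ⟨⌊a⌋₊, Nat.lt_succ_of_le (Nat.floor_le_floor hax.le),
        ENNReal.ofReal_le_ofReal (Nat.floor_le ha0), ?_⟩
      have h2 : ENNReal.ofReal (x - a) ≤ B ω := by
        rw [ENNReal.ofReal_sub _ ha0]
        exact tsub_le_iff_left.2 hω
      exact (ENNReal.ofReal_le_ofReal (by linarith [Nat.lt_floor_add_one a])).trans h2
  calc P {ω | ENNReal.ofReal x ≤ A ω + B ω}
      ≤ ∑ k ∈ Finset.range (⌊x⌋₊ + 1),
        P ({ω | ENNReal.ofReal k ≤ A ω} ∩ {ω | ENNReal.ofReal (x - k - 1) ≤ B ω}) :=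
        (measure_mono hsub).trans (measure_biUnion_finset_le _ _)
    _ ≤ ∑ k ∈ Finset.range (⌊x⌋₊ + 1), ENNReal.ofReal (4 * Real.exp (1 - x)) := by
        refine Finset.sum_le_sum fun k _ => ?_
        rw [hAB]
        refine (mul_le_mul' (hA k) (hB _)).trans (le_of_eq ?_)
        rw [← ENNReal.ofReal_ofNat 2, ← ENNReal.ofReal_mul (by norm_num),
          ← ENNReal.ofReal_mul (by norm_num), ← ENNReal.ofReal_mul (by positivity)]
        congr 1
        rw [mul_mul_mul_comm, ← Real.exp_add]
        norm_num
        ring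
    _ = ENNReal.ofReal ((⌊x⌋₊ + 1 : ℕ) * (4 * Real.exp (1 - x))) := by
        rw [Finset.sum_const, Finset.card_range, nsmul_eq_mul,
          ENNReal.ofReal_mul (p := ((⌊x⌋₊ + 1 : ℕ) : ℝ)) (by positivity), ENNReal.ofReal_natCast]
    _ ≤ ENNReal.ofReal ((x + 1) * (4 * Real.exp (1 - x))) := by
        refine ENNReal.ofReal_le_ofReal (mul_le_mul_of_nonneg_right ?_ (by positivity))
        push_cast
        linarith [Nat.floor_le hx]

/-- The closure of an interval is convex, so averages stay where the divergence is controlled by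
`rate`. -/
theorem ae_average_mem_closure [NeZero ρ] (hρ : ∀ᵐ x ∂ρ, x ∈ closure (meanSpace ρ))
    (hlaw : ∀ s, HasLaw (Y s) (expFam ρ θ₀) P) :
    ∀ᵐ ω ∂P, ∀ N : ℕ, 0 < N →
      (∑ s ∈ Finset.range N, Y s ω) / N ∈ closure (meanSpace ρ) := by
  have hac : expFam ρ θ₀ ≪ ρ := withDensity_absolutelyContinuous _ _
  have h1 : ∀ s, ∀ᵐ ω ∂P, Y s ω ∈ closure (meanSpace ρ) := fun s => by
    have h2 := hac.ae_le hρ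
    rw [← (hlaw s).map_eq] at h2
    exact ae_of_ae_map (hlaw s).aemeasurable h2
  have hconv : Convex ℝ (closure (meanSpace ρ)) :=
    (convex_iff_ordConnected.2 ordConnected_meanSpace).closure
  filter_upwards [ae_all_iff.2 h1] with ω hω N hN
  have hN' : (N : ℝ) ≠ 0 := by exact_mod_cast hN.ne'
  have h3 := hconv.sum_mem (t := Finset.range N) (w := fun _ => (1 : ℝ) / N)
    (z := fun s => Y s ω) (fun _ _ => by positivity) (by simp [hN']) (fun s _ => hω s)
  convert! h3 using 1
  simp only [smul_eq_mul, ← Finset.mul_sum]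
  ring

end Deviations

/-! ### Numbers of pulls -/

section Pulls

variable {n : ℕ} {ρ : Measure ℝ} {p : Params} {sel : (Fin n → ℝ) → Fin n}
  {alloc : Fin n → (Fin n → ℝ) → (Fin n → ℝ)} {x : Fin n → ℕ → ℝ}

theorem target_le (w : Fin n → ℝ) (T : ℝ≥0∞) (i : Fin n) : target p w T i ≤ ⌈p.L₂⌉₊ := by
  unfold target
  rcases le_total 0 p.L₂ with h | h
  · refine Nat.ceil_le_ceil ?_
    have := ENNReal.toReal_mono ENNReal.ofReal_ne_top (min_le_right
      (ENNReal.ofReal p.α * ENNReal.ofReal (w i) * T * ENNReal.ofReal (Real.log p.δ⁻¹))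
      (ENNReal.ofReal p.L₂))
    rwa [ENNReal.toReal_ofReal h] at this
  · simp [ENNReal.ofReal_of_nonpos h]

/-- Pull counts only grow, and the cap L₂ bounds every target, whatever the rewards and the
allocation are. -/
theorem stageTwo_mem_Icc {r M : ℕ} (hM : ⌈p.L₂⌉₊ ≤ M) (fuel : ℕ) (N : Fin n → ℕ)
    (w : Fin n → ℝ) (hN : ∀ i, N i ∈ Icc r M) (i : Fin n) :
    stageTwo ρ p sel alloc x fuel N w i ∈ Icc r M := by
  induction fuel generalizing N w with
  | zero => exact hN i
  | succ fuel ih =>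
    simp only [stageTwo]
    have hN' : ∀ w' T i, max (N i) (target p w' T i) ∈ Icc r M := fun w' T i =>
      ⟨(hN i).1.trans (le_max_left _ _), max_le (hN i).2 ((target_le w' T i).trans hM)⟩
    split_ifs
    · exact hN' _ _ i
    · exact ih _ _ fun i => hN' _ _ i

theorem pullsTau_mem_Icc {M : ℕ} (h₁ : ⌈p.L₁⌉₊ ≤ M) (h₂ : ⌈p.L₂⌉₊ ≤ M) (i : Fin n) :
    pullsTau ρ p sel alloc x i ∈ Icc ⌈p.L₁⌉₊ M :=
  stageTwo_mem_Icc h₂ _ _ _ (fun _ => ⟨le_rfl, h₁⟩) i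

theorem pullsFinal_eq (h₁ : ⌈p.L₁⌉₊ ≤ ⌈p.L₃⌉₊) (h₂ : ⌈p.L₂⌉₊ ≤ ⌈p.L₃⌉₊) :
    pullsFinal ρ p sel alloc x = fun _ => ⌈p.L₃⌉₊ :=
  funext fun i => max_eq_right (pullsTau_mem_Icc h₁ h₂ i).2

end Pulls

/-! ### Error probabilities -/

section Error

variable {n : ℕ} {ρ : Measure ℝ} {θ : Fin n → ℝ} {best : Fin n} {c : ℝ}
  {Ω : Type*} [MeasurableSpace Ω] {P : Measure Ω} {X : Fin n → ℕ → Ω → ℝ}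

theorem indepFun_average {ν : Fin n → Measure ℝ} (hlaw : ∀ i s, HasLaw (X i s) (ν i) P)
    (hind : iIndepFun (fun a : Fin n × ℕ => X a.1 a.2) P) {i j : Fin n} (hij : i ≠ j) (a b : ℕ) :
    IndepFun (fun ω => (∑ s ∈ Finset.range a, X i s ω) / a)
      (fun ω => (∑ s ∈ Finset.range b, X j s ω) / b) P := by
  have hinj : ∀ k : Fin n, Function.Injective fun s : ℕ => (k, s) := fun k s t h =>
    (Prod.ext_iff.1 h).2
  let S : Finset (Fin n × ℕ) := (Finset.range a).map ⟨fun s => (i, s), hinj i⟩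
  let T : Finset (Fin n × ℕ) := (Finset.range b).map ⟨fun s => (j, s), hinj j⟩
  have hST : Disjoint S T := by
    rw [Finset.disjoint_left]
    intro q hq hq'
    simp only [S, T, Finset.mem_map, Function.Embedding.coeFn_mk] at hq hq'
    obtain ⟨s, -, rfl⟩ := hq
    obtain ⟨t, -, ht⟩ := hq'
    exact hij (Prod.ext_iff.1 ht).1.symm
  have h1 := (hind.indepFun_finset₀ S T hST fun q => (hlaw q.1 q.2).aemeasurable).comp
    (φ := fun g => (∑ q, g q) / (a : ℝ)) (ψ := fun g => (∑ q, g q) / (b : ℝ))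
    (by fun_prop) (by fun_prop)
  convert! h1 using 1
  · ext ω
    simp only [Function.comp_apply]
    rw [Finset.sum_coe_sort S fun q => X q.1 q.2 ω, Finset.sum_map]
    rfl
  · ext ω
    simp only [Function.comp_apply]
    rw [Finset.sum_coe_sort T fun q => X q.1 q.2 ω, Finset.sum_map]
    rfl

theorem iIndepFun_arm (hind : iIndepFun (fun a : Fin n × ℕ => X a.1 a.2) P) (i : Fin n) :
    iIndepFun (X i) P :=
  hind.precomp (g := fun s : ℕ => (i, s)) fun _ _ h => (Prod.ext_iff.1 h).2

theorem measure_le_add_rate [NeZero ρ] (hθ : ∀ i, θ i ∈ paramSpace ρ)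
    (hlaw : ∀ i s, HasLaw (X i s) (expFam ρ (θ i)) P)
    (hind : iIndepFun (fun a : Fin n × ℕ => X a.1 a.2) P) {i j : Fin n} (hij : i ≠ j) {a b : ℕ}
    (ha : 0 < a) (hb : 0 < b) {y : ℝ} (hy : 0 ≤ y) :
    P {ω | ENNReal.ofReal y ≤ a * rate ρ (θ i) ((∑ s ∈ Finset.range a, X i s ω) / a) +
      b * rate ρ (θ j) ((∑ s ∈ Finset.range b, X j s ω) / b)} ≤
      ENNReal.ofReal ((y + 1) * (4 * Real.exp (1 - y))) := by
  have := hind.isProbabilityMeasure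
  refine measure_ofReal_le_add ?_
    (measure_le_average (hθ i) (hlaw i) (iIndepFun_arm hind i) ha)
    (measure_le_average (hθ j) (hlaw j) (iIndepFun_arm hind j) hb) hy
  intro k l
  exact (indepFun_average hlaw hind hij a b).measure_inter_preimage_eq_mul
    {u | ENNReal.ofReal k ≤ a * rate ρ (θ i) u} {u | ENNReal.ofReal l ≤ b * rate ρ (θ j) u}
    (measurableSet_le measurable_const ((measurable_rate _).const_mul _))
    (measurableSet_le measurable_const ((measurable_rate _).const_mul _))

/-- With probability at least `1 - n (M + 1)² (y + 1) 4 exp (1 - y)`, where `y = ℓ + c r`, no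
suboptimal arm beats the best one with `Z ≥ ℓ` at any sample sizes between `r` and `M`. -/
theorem measure_chernoffZ_le [NeZero ρ] (hρ : ∀ᵐ x ∂ρ, x ∈ closure (meanSpace ρ))
    (hθ : ∀ i, θ i ∈ paramSpace ρ) (hc : 0 ≤ c)
    (hsep : ∀ i, i ≠ best → Separated ρ (θ i) (θ best) c)
    (hlaw : ∀ i s, HasLaw (X i s) (expFam ρ (θ i)) P)
    (hind : iIndepFun (fun a : Fin n × ℕ => X a.1 a.2) P) {r M : ℕ} (hr : 0 < r) {ℓ y : ℝ}
    (hℓ : 0 < ℓ) (hy : 0 ≤ y) (hyr : y ≤ ℓ + c * r) :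
    P {ω | ∃ i, i ≠ best ∧ ∃ N : Fin n → ℕ, (∀ k, N k ∈ Icc r M) ∧
        empMean (fun i s => X i s ω) N best ≤ empMean (fun i s => X i s ω) N i ∧
        ENNReal.ofReal ℓ ≤ chernoffZ ρ (fun i s => X i s ω) N i best} ≤
      ENNReal.ofReal (n * ((M + 1) ^ 2 * ((y + 1) * (4 * Real.exp (1 - y))))) := by
  have := hind.isProbabilityMeasure
  have hcl : ∀ᵐ ω ∂P, ∀ i, ∀ N : ℕ, 0 < N →
      (∑ s ∈ Finset.range N, X i s ω) / N ∈ closure (meanSpace ρ) :=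
    ae_all_iff.2 fun i => ae_average_mem_closure hρ (hlaw i)
  -- A data-dependent count vector enters only through its two entries for `i` and `best`, so pairs
  -- of deterministic sample sizes cover the event.
  let E : Fin n → ℕ → ℕ → Set Ω := fun i a b => {ω | i ≠ best ∧ 0 < a ∧ 0 < b ∧
    ENNReal.ofReal y ≤ a * rate ρ (θ i) ((∑ s ∈ Finset.range a, X i s ω) / a) +
      b * rate ρ (θ best) ((∑ s ∈ Finset.range b, X best s ω) / b)}
  have hE : ∀ i a b, P (E i a b) ≤ ENNReal.ofReal ((y + 1) * (4 * Real.exp (1 - y))) := by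
    intro i a b
    by_cases h : i ≠ best ∧ 0 < a ∧ 0 < b
    · exact (measure_mono fun ω hω => hω.2.2.2).trans
        (measure_le_add_rate hθ hlaw hind h.1 h.2.1 h.2.2 hy)
    · have : E i a b = ∅ := by
        ext ω
        simp only [E, mem_ofPred_eq, mem_empty_iff_false, iff_false]
        tauto
      simp [this]
  calc P _ ≤ P (⋃ i ∈ (Finset.univ : Finset (Fin n)),
        ⋃ q ∈ Finset.range (M + 1) ×ˢ Finset.range (M + 1), E i q.1 q.2) := by
        refine measure_mono_ae ?_
        filter_upwards [hcl] with ω hω ⟨i, hi, N, hN, hle, hZ⟩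
        refine mem_iUnion₂.2 ⟨i, Finset.mem_univ i, mem_iUnion₂.2 ⟨(N i, N best), ?_, ?_⟩⟩
        · have h1 := (hN i).2
          have h2 := (hN best).2
          simp only [Finset.mem_product, Finset.mem_range]
          omega
        · have h1 := hr.trans_le (hN i).1
          have h2 := hr.trans_le (hN best).1
          refine ⟨hi, h1, h2, ?_⟩
          have hne : chernoffZ ρ (fun i s => X i s ω) N i best ≠ 0 :=
            ((ENNReal.ofReal_pos.2 hℓ).trans_le hZ).ne'
          have := kl_add_kl_le hc (hsep i hi) (hω i _ h1) (hω best _ h2) hle h1 h2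
            (hN i).1 (hN best).1 rfl hne
          refine le_trans ?_ this
          refine (ENNReal.ofReal_le_ofReal hyr).trans ?_
          rw [ENNReal.ofReal_add hℓ.le (by positivity)]
          exact add_le_add_left hZ _
    _ ≤ ∑ i : Fin n, ∑ q ∈ Finset.range (M + 1) ×ˢ Finset.range (M + 1),
        ENNReal.ofReal ((y + 1) * (4 * Real.exp (1 - y))) :=
        (measure_biUnion_finset_le _ _).trans (Finset.sum_le_sum fun i _ =>
          (measure_biUnion_finset_le _ _).trans (Finset.sum_le_sum fun q _ => hE i _ _))
    _ = ENNReal.ofReal (n * ((M + 1) ^ 2 * ((y + 1) * (4 * Real.exp (1 - y))))) := by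
        rw [Finset.sum_const, Finset.sum_const, Finset.card_product, Finset.card_range,
          Finset.card_univ, Fintype.card_fin, nsmul_eq_mul, nsmul_eq_mul,
          ENNReal.ofReal_mul (p := (n : ℝ)) (by positivity), ENNReal.ofReal_natCast,
          ENNReal.ofReal_mul (p := ((M : ℝ) + 1) ^ 2) (by positivity),
          show ((M : ℝ) + 1) ^ 2 = (((M + 1) * (M + 1) : ℕ) : ℝ) by push_cast; ring,
          ENNReal.ofReal_natCast]

theorem measure_average_best_le [NeZero ρ] (hθ : ∀ i, θ i ∈ paramSpace ρ)
    (hsep : ∀ i, i ≠ best → Separated ρ (θ i) (θ best) c)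
    (hlaw : ∀ i s, HasLaw (X i s) (expFam ρ (θ i)) P)
    (hind : iIndepFun (fun a : Fin n × ℕ => X a.1 a.2) P) {N : ℕ} (hN : 0 < N) :
    P {ω | ∃ i, i ≠ best ∧ empMean (fun i s => X i s ω) (fun _ => N) best ≤
        empMean (fun i s => X i s ω) (fun _ => N) i} ≤
      ENNReal.ofReal (n * (4 * Real.exp (-(N * c)))) := by
  let D : Fin n → Set Ω := fun i => {ω | ENNReal.ofReal (N * c) ≤
    N * rate ρ (θ i) ((∑ s ∈ Finset.range N, X i s ω) / N)}
  have hD : ∀ i, P (D i) ≤ 2 * ENNReal.ofReal (Real.exp (-(N * c))) := fun i =>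
    measure_le_average (hθ i) (hlaw i) (iIndepFun_arm hind i) hN _
  calc P _ ≤ P (⋃ i ∈ (Finset.univ : Finset (Fin n)), (D i ∪ D best)) := by
        refine measure_mono fun ω ⟨i, hi, hle⟩ => ?_
        refine mem_iUnion₂.2 ⟨i, Finset.mem_univ i, ?_⟩
        refine ((hsep i hi).le_rate hle).imp (fun h => ?_) (fun h => ?_)
        all_goals
          simp only [D, mem_ofPred_eq]
          rw [ENNReal.ofReal_mul (by positivity), ENNReal.ofReal_natCast]
          exact mul_le_mul_right h _
    _ ≤ ∑ i : Fin n, 4 * ENNReal.ofReal (Real.exp (-(N * c))) := by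
        refine (measure_biUnion_finset_le _ _).trans (Finset.sum_le_sum fun i _ => ?_)
        refine (measure_union_le _ _).trans ((add_le_add (hD i) (hD best)).trans (le_of_eq ?_))
        rw [← add_mul]; norm_num
    _ = ENNReal.ofReal (n * (4 * Real.exp (-(N * c)))) := by
        rw [Finset.sum_const, Finset.card_univ, Fintype.card_fin, nsmul_eq_mul,
          ENNReal.ofReal_mul (p := (n : ℝ)) (by positivity), ENNReal.ofReal_natCast,
          ENNReal.ofReal_mul (p := 4) (by positivity), ENNReal.ofReal_ofNat]

end Error

/-! ### Asymptotics -/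

/-- In y = √L the left side is polynomial of degree 10. -/
theorem eventually_poly_le_exp {c : ℝ} (hc : 0 < c) (K : ℝ) :
    ∀ᶠ L : ℝ in atTop, K * ((L ^ 2 + 2) ^ 2 * (L + c * √L + 2)) ≤ Real.exp (c * √L) := by
  have h1 := (isLittleO_pow_exp_pos_mul_atTop 10 hc).bound
    (show (0 : ℝ) < 1 / ((|K| + 1) * (9 * (3 + c))) by positivity)
  have h2 : Tendsto (fun L : ℝ => √L) atTop atTop := Real.tendsto_sqrt_atTop
  filter_upwards [h2.eventually h1, h2.eventually_ge_atTop 1, eventually_ge_atTop 0]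
    with L hL hy h0
  set y := √L
  have hLy : L = y ^ 2 := (Real.sq_sqrt h0).symm
  rw [Real.norm_of_nonneg (by positivity), Real.norm_of_nonneg (by positivity), one_div,
    inv_mul_eq_div, le_div_iff₀ (by positivity)] at hL
  have e1 : L ^ 2 + 2 ≤ 3 * y ^ 4 := by
    have : 1 ≤ y ^ 4 := one_le_pow₀ hy
    rw [hLy]; nlinarith
  have e2 : L + c * y + 2 ≤ (3 + c) * y ^ 2 := by
    have : y ≤ y ^ 2 := by nlinarith
    rw [hLy]; nlinarith [mul_le_mul_of_nonneg_left this hc.le]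
  have e3 : 0 ≤ L + c * y + 2 := by positivity
  calc K * ((L ^ 2 + 2) ^ 2 * (L + c * y + 2))
      ≤ (|K| + 1) * ((3 * y ^ 4) ^ 2 * ((3 + c) * y ^ 2)) := by
        gcongr
        linarith [le_abs_self K]
    _ = y ^ 10 * ((|K| + 1) * (9 * (3 + c))) := by ring
    _ ≤ Real.exp (c * y) := hL

theorem eventually_mul_exp_le_exp_sq {c : ℝ} (hc : 0 < c) (K : ℝ) :
    ∀ᶠ L : ℝ in atTop, K * Real.exp L ≤ Real.exp (c * L ^ 2) := by
  filter_upwards [Real.tendsto_exp_atTop.eventually_ge_atTop K, eventually_ge_atTop (2 / c),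
    eventually_ge_atTop 0] with L h1 h2 h0
  rw [div_le_iff₀ hc] at h2
  calc K * Real.exp L ≤ Real.exp L * Real.exp L := by gcongr
    _ = Real.exp (L + L) := (Real.exp_add _ _).symm
    _ ≤ Real.exp (c * L ^ 2) := Real.exp_le_exp.2 (by nlinarith)

/-! ### The parameters of Tri-BBAI -/

section Main

variable {n : ℕ} {α δ : ℝ}

theorem asymParams_pulls_le (hn : 0 < n) (hL : 1 ≤ Real.log δ⁻¹) :
    ⌈(asymParams n α δ).L₁⌉₊ ≤ ⌈(asymParams n α δ).L₃⌉₊ ∧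
      ⌈(asymParams n α δ).L₂⌉₊ ≤ ⌈(asymParams n α δ).L₃⌉₊ := by
  simp only [asymParams]
  set L := Real.log δ⁻¹
  have hn' : (1 : ℝ) ≤ n := by exact_mod_cast hn
  have h1 : L ≤ L ^ 2 := by nlinarith
  refine ⟨Nat.ceil_le_ceil ?_, Nat.ceil_le_ceil ?_⟩
  · refine (Real.sqrt_le_sqrt h1).trans ?_
    rwa [Real.sqrt_sq (by linarith)]
  · have h2 : 0 ≤ Real.log L := Real.log_nonneg hL
    have h3 : Real.log L ≤ L := by linarith [Real.log_le_sub_one_of_pos (by linarith : 0 < L)]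
    calc L * Real.log L / n ≤ L * Real.log L := div_le_self (by positivity) hn'
      _ ≤ L ^ 2 := by nlinarith

/-- The factors log(2/δ) and t^α are at least 1; only log(2/δ) of the threshold is kept. -/
theorem log_le_asymParams_β (hδ : 0 < δ) (hL : 1 ≤ Real.log δ⁻¹) (hα : 0 ≤ α) {t : ℝ}
    (ht : 1 ≤ t) : Real.log δ⁻¹ + Real.log 2 ≤ (asymParams n α δ).β t (δ / 2) := by
  have h2 : Real.log (2 / δ) = Real.log δ⁻¹ + Real.log 2 := by
    rw [div_eq_mul_inv, Real.log_mul (by norm_num) (by positivity), add_comm]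
  simp only [asymParams]
  rw [← h2, one_div_div]
  refine Real.log_le_log (by positivity) ?_
  have h3 : 1 ≤ Real.log (2 / δ) := by
    rw [h2]; linarith [Real.log_pos (by norm_num : (1 : ℝ) < 2)]
  have h4 : 1 ≤ t ^ α := Real.one_le_rpow ht hα
  rw [show 2 / δ = 1 / (δ / 2) by field_simp]
  gcongr
  rw [one_div_div]
  nlinarith

end Main

/-! ### A common margin for all arms, and the two error bounds. -/

theorem exists_separated_of_best {n : ℕ} {ρ : Measure ℝ} [NeZero ρ] {μ : Fin n → ℝ}
    (hμ : ∀ i, μ i ∈ meanSpace ρ) {best : Fin n} (hbest : ∀ i, i ≠ best → μ i < μ best) :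
    ∃ c, 0 < c ∧ ∀ i, i ≠ best →
      Separated ρ (natParam ρ (μ i)) (natParam ρ (μ best)) c := by
  have h : ∀ i, ∀ᶠ c : ℝ in 𝓝[>] 0, i ≠ best →
      Separated ρ (natParam ρ (μ i)) (natParam ρ (μ best)) c := by
    intro i
    by_cases hi : i = best
    · exact .of_forall fun _ h => absurd hi h
    · obtain ⟨c, hc, hs⟩ := exists_separated (natParam_mem (hμ i)) (natParam_mem (hμ best))
        (by rw [famMean_natParam (hμ i), famMean_natParam (hμ best)]; exact hbest i hi)
      filter_upwards [Ioc_mem_nhdsGT hc] with c' hc' _ using hs.mono hc'.2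
  obtain ⟨c, hs, hc⟩ := ((eventually_all.2 h).and self_mem_nhdsWithin).exists
  exact ⟨c, hc, hs⟩

section Correctness

variable {n : ℕ} {ρ : Measure ℝ} {θ : Fin n → ℝ} {best : Fin n} {c α δ : ℝ}
  {sel : (Fin n → ℝ) → Fin n} {alloc : Fin n → (Fin n → ℝ) → (Fin n → ℝ)}
  {Ω : Type*} [MeasurableSpace Ω] {P : Measure Ω} {X : Fin n → ℕ → Ω → ℝ}

theorem measure_chernoffStop_wrong_le [NeZero ρ] (hρ : ∀ᵐ x ∂ρ, x ∈ closure (meanSpace ρ))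
    (hθ : ∀ i, θ i ∈ paramSpace ρ) (hc : 0 ≤ c)
    (hsep : ∀ i, i ≠ best → Separated ρ (θ i) (θ best) c) (hsel : IsArgmaxRule sel)
    (hlaw : ∀ i s, HasLaw (X i s) (expFam ρ (θ i)) P)
    (hind : iIndepFun (fun a : Fin n × ℕ => X a.1 a.2) P)
    (hα : 0 ≤ α) (hδ : 0 < δ) (hL : 1 ≤ Real.log δ⁻¹)
    (hlarge : (n * 4 * Real.exp 1) * ((Real.log δ⁻¹ ^ 2 + 2) ^ 2 *
      (Real.log δ⁻¹ + c * √(Real.log δ⁻¹) + 2)) ≤ Real.exp (c * √(Real.log δ⁻¹))) :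
    P {ω | ChernoffStop ρ (asymParams n α δ) sel alloc (fun i s => X i s ω) ∧
      output ρ (asymParams n α δ) sel alloc (fun i s => X i s ω) ≠ best} ≤
      ENNReal.ofReal (δ / 2) := by
  have hn : 0 < n := best.pos
  obtain ⟨hp₁, hp₂⟩ := asymParams_pulls_le (α := α) hn hL
  set p := asymParams n α δ
  set L := Real.log δ⁻¹
  have hlog2 : 0 < Real.log 2 := Real.log_pos (by norm_num)
  have hlog2' : Real.log 2 ≤ 1 := by linarith [Real.log_le_sub_one_of_pos (zero_lt_two' ℝ)]
  have hL₁ : √L ≤ ⌈p.L₁⌉₊ := Nat.le_ceil _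
  have hr : 0 < ⌈p.L₁⌉₊ := Nat.ceil_pos.2 (Real.sqrt_pos.2 (by linarith))
  -- Here ℓ = log(2/δ) supplies the factor δ/2, and the margin c√L in `y` supplies the factor that
  -- absorbs the union bound.
  refine le_trans (measure_mono fun ω => ?_) ((measure_chernoffZ_le hρ hθ hc hsep hlaw hind
    (r := ⌈p.L₁⌉₊) (M := ⌈p.L₃⌉₊) (ℓ := L + Real.log 2) (y := L + Real.log 2 + c * √L) hr
    (by linarith) (by positivity) (by gcongr)).trans (ENNReal.ofReal_le_ofReal ?_))
  · rintro ⟨hcs, hout⟩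
    rw [output, if_pos hcs] at hout
    have hN := pullsTau_mem_Icc (ρ := ρ) (sel := sel) (alloc := alloc)
      (x := fun i s => X i s ω) hp₁ hp₂
    refine ⟨_, hout, pullsTau ρ p sel alloc fun i s => X i s ω, hN, hsel _ _, ?_⟩
    -- The stopping condition is needed only against the true best arm.
    refine le_trans (ENNReal.ofReal_le_ofReal (log_le_asymParams_β hδ hL hα ?_))
      (hcs best (Ne.symm hout))
    have h1 := hr.trans_le (hN best).1
    have h2 := Finset.single_le_sum (f := pullsTau ρ p sel alloc fun i s => X i s ω)
      (fun _ _ => Nat.zero_le _) (Finset.mem_univ best)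
    exact_mod_cast h1.trans_le h2
  · have hM : (⌈p.L₃⌉₊ : ℝ) + 1 ≤ L ^ 2 + 2 := by
      have := Nat.ceil_lt_add_one (show 0 ≤ p.L₃ from sq_nonneg L)
      have h3 : p.L₃ = L ^ 2 := rfl
      linarith
    have hexp : Real.exp (1 - (L + Real.log 2 + c * √L)) =
        Real.exp 1 * (δ / 2) * (Real.exp (c * √L))⁻¹ := by
      rw [show 1 - (L + Real.log 2 + c * √L) = 1 + (-L - Real.log 2) + -(c * √L) by ring,
        Real.exp_add, Real.exp_add, Real.exp_neg, Real.exp_sub, Real.exp_log zero_lt_two,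
        Real.exp_neg, Real.exp_log (inv_pos.2 hδ), inv_inv]
    calc (n : ℝ) * ((⌈p.L₃⌉₊ + 1) ^ 2 * ((L + Real.log 2 + c * √L + 1) *
          (4 * Real.exp (1 - (L + Real.log 2 + c * √L)))))
        ≤ n * ((L ^ 2 + 2) ^ 2 * ((L + c * √L + 2) *
          (4 * Real.exp (1 - (L + Real.log 2 + c * √L))))) := by
          gcongr ?_ * (?_ * (?_ * ?_))
          · gcongr
          · linarith
      _ = (n * 4 * Real.exp 1) * ((L ^ 2 + 2) ^ 2 * (L + c * √L + 2)) *
          (Real.exp (c * √L))⁻¹ * (δ / 2) := by rw [hexp]; ring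
      _ ≤ Real.exp (c * √L) * (Real.exp (c * √L))⁻¹ * (δ / 2) := by gcongr
      _ = δ / 2 := by rw [mul_inv_cancel₀ (Real.exp_pos _).ne', one_mul]

theorem measure_not_chernoffStop_wrong_le [NeZero ρ] (hθ : ∀ i, θ i ∈ paramSpace ρ) (hc : 0 ≤ c)
    (hsep : ∀ i, i ≠ best → Separated ρ (θ i) (θ best) c) (hsel : IsArgmaxRule sel)
    (hlaw : ∀ i s, HasLaw (X i s) (expFam ρ (θ i)) P)
    (hind : iIndepFun (fun a : Fin n × ℕ => X a.1 a.2) P)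
    (hδ : 0 < δ) (hL : 1 ≤ Real.log δ⁻¹)
    (hlarge : (n * 8) * Real.exp (Real.log δ⁻¹) ≤ Real.exp (c * Real.log δ⁻¹ ^ 2)) :
    P {ω | ¬ ChernoffStop ρ (asymParams n α δ) sel alloc (fun i s => X i s ω) ∧
      output ρ (asymParams n α δ) sel alloc (fun i s => X i s ω) ≠ best} ≤
      ENNReal.ofReal (δ / 2) := by
  obtain ⟨hp₁, hp₂⟩ := asymParams_pulls_le (α := α) best.pos hL
  set p := asymParams n α δ
  set L := Real.log δ⁻¹ with hLdef
  have hpos : 0 < ⌈p.L₃⌉₊ := Nat.ceil_pos.2 (show 0 < L ^ 2 by positivity)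
  refine le_trans (measure_mono fun ω => ?_) ((measure_average_best_le hθ hsep hlaw hind
    hpos).trans (ENNReal.ofReal_le_ofReal ?_))
  · rintro ⟨hcs, hout⟩
    rw [output, if_neg hcs, pullsFinal_eq hp₁ hp₂] at hout
    exact ⟨_, hout, hsel _ _⟩
  · have h1 : L ^ 2 ≤ ⌈p.L₃⌉₊ := Nat.le_ceil (L ^ 2)
    rw [hLdef, Real.exp_log (inv_pos.2 hδ), ← hLdef] at hlarge
    calc (n : ℝ) * (4 * Real.exp (-(⌈p.L₃⌉₊ * c)))
        ≤ n * (4 * Real.exp (-(c * L ^ 2))) := by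
          rw [mul_comm c]
          gcongr
      _ = (n * 8) * δ⁻¹ * (Real.exp (c * L ^ 2))⁻¹ * (δ / 2) := by
          rw [Real.exp_neg]; field_simp; ring
      _ ≤ Real.exp (c * L ^ 2) * (Real.exp (c * L ^ 2))⁻¹ * (δ / 2) := by gcongr
      _ = δ / 2 := by rw [mul_inv_cancel₀ (Real.exp_pos _).ne', one_mul]

end Correctness

theorem not_hasLaw_armLaw_zero {Ω : Type*} [MeasurableSpace Ω] {P : Measure Ω}
    [IsProbabilityMeasure P] {Y : Ω → ℝ} (m : ℝ) : ¬ HasLaw Y (armLaw 0 m) P := by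
  intro h
  have := Measure.isProbabilityMeasure_map h.aemeasurable
  have h1 : P.map Y = 0 := by rw [h.map_eq, armLaw, expFam, withDensity_zero_left]
  exact IsProbabilityMeasure.ne_zero _ h1

end TriBBAI

theorem theorem2 {n : ℕ} (ρ : Measure ℝ)
    (hρ : ∀ᵐ x ∂ρ, x ∈ closure (TriBBAI.meanSpace ρ))
    (μ : Fin n → ℝ) (hμ : ∀ i, μ i ∈ TriBBAI.meanSpace ρ)
    (best : Fin n) (hbest : ∀ i, i ≠ best → μ i < μ best)
    (α : ℝ) (hα : 1 < α) (hα' : α ≤ Real.exp 1 / 2) :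
    ∃ δ₀ : ℝ, 0 < δ₀ ∧ ∀ δ : ℝ, 0 < δ → δ < δ₀ →
      ∀ (sel : (Fin n → ℝ) → Fin n) (alloc : Fin n → (Fin n → ℝ) → (Fin n → ℝ)),
        TriBBAI.IsArgmaxRule sel → TriBBAI.IsAllocRule ρ alloc →
      ∀ (Ω : Type*) [MeasurableSpace Ω] (P : Measure Ω) [IsProbabilityMeasure P]
        (X : Fin n → ℕ → Ω → ℝ),
        (∀ i s, HasLaw (X i s) (TriBBAI.armLaw ρ (μ i)) P) →
        iIndepFun (fun (a : Fin n × ℕ) => X a.1 a.2) P →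
        P {ω | TriBBAI.ChernoffStop ρ (TriBBAI.asymParams n α δ) sel alloc (fun i s => X i s ω) ∧
            TriBBAI.output ρ (TriBBAI.asymParams n α δ) sel alloc (fun i s => X i s ω) ≠ best}
          ≤ ENNReal.ofReal (δ / 2) ∧
        P {ω | ¬ TriBBAI.ChernoffStop ρ (TriBBAI.asymParams n α δ) sel alloc
              (fun i s => X i s ω) ∧
            TriBBAI.output ρ (TriBBAI.asymParams n α δ) sel alloc (fun i s => X i s ω) ≠ best}
          ≤ ENNReal.ofReal (δ / 2) ∧
        P {ω | TriBBAI.output ρ (TriBBAI.asymParams n α δ) sel alloc (fun i s => X i s ω) ≠ best}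
          ≤ ENNReal.ofReal δ := by
  -- For ρ = 0 every member of the family is the zero measure, which is no law of a reward.
  rcases eq_or_ne ρ 0 with rfl | hne
  · exact ⟨1, one_pos, fun δ _ _ sel alloc _ _ Ω _ P _ X hlaw _ =>
      (TriBBAI.not_hasLaw_armLaw_zero _ (hlaw best 0)).elim⟩
  have : NeZero ρ := ⟨hne⟩
  obtain ⟨c, hc, hsep⟩ := TriBBAI.exists_separated_of_best hμ hbest
  obtain ⟨L₀, hL₀⟩ := eventually_atTop.1 (((TriBBAI.eventually_poly_le_exp hc
    (n * 4 * Real.exp 1)).and (TriBBAI.eventually_mul_exp_le_exp_sq hc (n * 8))).and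
    (eventually_ge_atTop 1))
  refine ⟨Real.exp (-L₀), Real.exp_pos _, ?_⟩
  intro δ hδ hlt sel alloc hsel _ Ω _ P _ X hlaw hind
  have hL : L₀ ≤ Real.log δ⁻¹ := by
    rw [Real.log_inv, le_neg]
    exact ((Real.log_lt_iff_lt_exp hδ).2 hlt).le
  obtain ⟨⟨h1, h2⟩, h3⟩ := hL₀ _ hL
  have hθ := fun i => TriBBAI.natParam_mem (hμ i)
  have e1 := TriBBAI.measure_chernoffStop_wrong_le (alloc := alloc) hρ hθ hc.le hsep hsel hlaw hind
    (by linarith : 0 ≤ α) hδ h3 h1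
  have e2 := TriBBAI.measure_not_chernoffStop_wrong_le (alloc := alloc) (α := α) hθ hc.le hsep hsel hlaw
    hind hδ h3 h2
  refine ⟨e1, e2, ?_⟩
  calc _ ≤ _ := measure_mono fun ω hω => ?_
    _ ≤ _ := measure_union_le _ _
    _ ≤ ENNReal.ofReal (δ / 2) + ENNReal.ofReal (δ / 2) := add_le_add e1 e2
    _ = ENNReal.ofReal δ := by rw [← ENNReal.ofReal_add (by positivity) (by positivity), add_halves]
  exact (em _).imp (fun h => ⟨h, hω⟩) (fun h => ⟨h, hω⟩)
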